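/- Let $0<\alpha<1$, let $k\ge 1$ be an integer, and let $\mathcal R(k,k)$ be the set of real rational functions $P/Q$ with $\deg P\le k$, $\deg Q\le k$ and $Q$ monic. Let $r_{1-\alpha}$ be a best approximation of $t^{\alpha}$ in $\mathcal R(k,k)$ with respect to $\|\cdot\|_{L^\infty(0,1)}$ (one exists), and let $E_{1-\alpha,k,k}=\|r_{1-\alpha}(t)-t^\alpha\|_{L^\infty(0,1)}$ be its error. Then $r_{1-\alpha}(t)-t^{\alpha}$ has exactly $2k+1$ zeros $\xi_1<\xi_2<\dots<\xi_{2k+1}$ in $(0,1)$, and the following holds. For a symmetric positive definite matrix $\mathbb A\in\mathbb R^{N\times N}$, $N\ge 1$, with smallest eigenvalue $\lambda_1$, put $\mathbb C=\|\mathbb A\|_\infty=\max_i\sum_j|a_{ij}|$, $\mathcal A=\mathbb C^{-1}\mathbb A$ and $\mu_1=\mathbb C^{-1}\lambda_1$. For $\mathbf f\in\mathbb R^N\setminus\{0\}$ let $\mathbf u=\mathbb A^{-\alpha}\mathbf f$, where $\mathbb A^{-\alpha}$ is defined through the spectral decomposition of $\mathbb A$, and let $\mathbf u_r=\mathbb C^{-\alpha}\,r_{1-\alpha}(\mathcal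 A)^{-1}\mathbf f$ be the $(k,k)$-R-BURA approximation. Then $r_{1-\alpha}(\mathcal A)$ is well defined and invertible, and: (1) if $\mu_1\in\bigcup_{i=1}^{k}[\xi_{2i},\xi_{2i+1}]$, then for all $\mathbf f\ne 0$ $$\frac{\|\mathbf u_r-\mathbf u\|_2}{\|\mathbf f\|_2}\le\frac{\mathbb C^{\alpha}E_{1-\alpha,k,k}}{\lambda_1^{2\alpha}};$$ (2) if $\mu_1\in[0,\xi_1]$, then for all $\mathbf f\ne 0$ $$\frac{\|\mathbf u_r-\mathbf u\|_2}{\|\mathbf f\|_2}\le\lambda_1^{-\alpha};$$ (3) (uniform boundedness for fixed $k$) if $(\mathbb A_h)$ is a family of symmetric positive definite matrices, of arbitrary sizes $N_h\ge1$, such that as $h\to0$ one has $\lambda_1(\mathbb A_h)\ge c$ for a constant $c>0$ and $\mu_1(\mathbb A_h)\to0$, then for all $h$ sufficiently close to the limit and all $\mathbf f\ne 0$ the relative error $\|\mathbf u_r-\mathbf u\|_2/\|\mathbf f\|_2$ for $\mathbb A_h$ is at most $\lambda_1(\mathbb A_h)^{-\alpha}$, hence at most $c^{-\alpha}$. -/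

import Mathlib

open Filter Topology

noncomputable section

namespace RBURA

/-- The class `R(k,m)` of rational functions `P / Q` with `deg P ≤ k`, `deg Q ≤ m`, `Q` monic. -/
def ratClass (k m : ℕ) : Set (RatFunc ℝ) :=
  {r | ∃ P Q : Polynomial ℝ, P.natDegree ≤ k ∧ Q.natDegree ≤ m ∧ Q.Monic ∧
    r = algebraMap (Polynomial ℝ) (RatFunc ℝ) P / algebraMap (Polynomial ℝ) (RatFunc ℝ) Q}

/-- The value `r(t)`, computed from the reduced form of `r`
(the value `0` is returned at a pole). -/
def val (r : RatFunc ℝ) (t : ℝ) : ℝ := RatFunc.eval (RingHom.id ℝ) t r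

/-- The distance `‖t ^ (1 - α) - r(t)‖` in `L^∞(0,1)`; it is `∞` if `r` has a pole in `[0,1]`. -/
def supError (α : ℝ) (r : RatFunc ℝ) : ENNReal :=
  MeasureTheory.eLpNorm (fun t : ℝ => t ^ (1 - α) - val r t) ⊤
    (MeasureTheory.volume.restrict (Set.Ioo (0 : ℝ) 1))

/-- `r` is a best uniform rational approximation `r_α` of `t ^ (1 - α)` in `R(k,m)`. -/
def IsBURA (α : ℝ) (k m : ℕ) (r : RatFunc ℝ) : Prop :=
  r ∈ ratClass k m ∧ ∀ s ∈ ratClass k m, supError α r ≤ supError α s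

/-- The error `E_{α,k,m}` of the best uniform approximation of `t ^ (1 - α)` in `R(k,m)`. -/
def bestError (α : ℝ) (k m : ℕ) : ℝ := (⨅ r ∈ ratClass k m, supError α r).toReal

variable {N : ℕ}

/-- `ℂ = ‖A‖_∞ = max_i ∑_j |a_ij|`. -/
def rowNorm (A : Matrix (Fin N) (Fin N) ℝ) : ℝ := ⨆ i, ∑ j, |A i j|

/-- The smallest eigenvalue `λ₁` of `A`. -/
def lamMin (A : Matrix (Fin N) (Fin N) ℝ) : ℝ := sInf (spectrum ℝ A)

/-- The rescaled matrix `𝒜 = ℂ⁻¹ A`. -/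
def rescaled (A : Matrix (Fin N) (Fin N) ℝ) : Matrix (Fin N) (Fin N) ℝ := (rowNorm A)⁻¹ • A

/-- `μ₁ = ℂ⁻¹ λ₁`, the smallest eigenvalue of the rescaled matrix. -/
def muMin (A : Matrix (Fin N) (Fin N) ℝ) : ℝ := (rowNorm A)⁻¹ * lamMin A

/-- `A ^ s = W D ^ s Wᵀ`, where `A = W D Wᵀ` is the spectral decomposition of `A`. -/
def fracPow {A : Matrix (Fin N) (Fin N) ℝ} (hA : A.IsHermitian) (s : ℝ) :
    Matrix (Fin N) (Fin N) ℝ := hA.cfc (fun x => x ^ s)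

/-- The matrix `r(M) = P(M) Q(M)⁻¹`, where `r = P / Q` in lowest terms. -/
def ratMat (r : RatFunc ℝ) (M : Matrix (Fin N) (Fin N) ℝ) : Matrix (Fin N) (Fin N) ℝ :=
  Polynomial.aeval M r.num * (Polynomial.aeval M r.denom)⁻¹

/-- The exact solution `u = A ^ (-α) f`. -/
def exactSol (α : ℝ) {A : Matrix (Fin N) (Fin N) ℝ} (hA : A.IsHermitian)
    (f : EuclideanSpace ℝ (Fin N)) : EuclideanSpace ℝ (Fin N) :=
  Matrix.toEuclideanLin (fracPow hA (-α)) f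

/-- The R-BURA approximation `u_r = ℂ ^ (-α) r(𝒜)⁻¹ f`. -/
def approxSol (α : ℝ) (r : RatFunc ℝ) (A : Matrix (Fin N) (Fin N) ℝ)
    (f : EuclideanSpace ℝ (Fin N)) : EuclideanSpace ℝ (Fin N) :=
  (rowNorm A) ^ (-α) • Matrix.toEuclideanLin (ratMat r (rescaled A))⁻¹ f

/-- The relative error `‖u_r - u‖₂ / ‖f‖₂`. -/
def relError (α : ℝ) (r : RatFunc ℝ) {A : Matrix (Fin N) (Fin N) ℝ} (hA : A.IsHermitian)
    (f : EuclideanSpace ℝ (Fin N)) : ℝ :=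
  ‖approxSol α r A f - exactSol α hA f‖ / ‖f‖

end RBURA

end

namespace RBURA

open Polynomial MeasureTheory

/-! Everything rests on the Stieltjes-type formula `t ^ α = c ∫ x ^ α (1/x - 1/(x + t)) dx` over `x
> 0`, with `c > 0`. The divided difference of `1/(x + t)` in `t` has a known sign and divided
differences kill polynomials of low degree, so those of `s(t) t ^ α` have a definite sign whenever
`s ≥ 0` on the negative half-line (`divDiff_mul_rpow_pos`). Let `P/Q` of type `(m,m)` interpolate `t
^ α` at `2m+1` positive nodes. Since `p Q t ^ α = p P` at the nodes, choosing suitable `p` shows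
that `Q` has `m` distinct negative roots and that all residues of `P/Q` are negative. Hence `P/Q`
increases on `[0, ∞)`. Adding one more node gives the sign of `P/Q - t ^ α` between nodes and bounds
its positive zeros by `2m+1`. A best approximation exists by compactness. If its reduced form, with
`m` the larger degree, had at most `k+m` zeros of the error, a polynomial `w` of degree at most
`k+m` would share the sign of the error. Bézout writes `w`, up to a sign, as `Q a - P b`, and `(P -
ε a)/(Q - ε b)` would be better (`exists_better_approx`). So `k+m+1 ≤ 2m+1`, which forces `m = k`
and exactly `2k+1` zeros. On `(0, ξ₁]` and on `[ξ_{2i}, ξ_{2i+1}]` one has `r(t) ≥ t ^ α`. If `μ₁`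
lies there, monotonicity gives `r(μ) ≥ r(μ₁) ≥ μ₁ ^ α` for every eigenvalue `μ` of the rescaled
matrix. The bounds then follow from scalar estimates of `1/r(μ) - μ ^ (-α)` in the eigenbasis. -/

/-! ### Divided differences of `s(t) t ^ α`. -/

/-- The divided difference of `g` over the finite set `S` of nodes. -/
noncomputable def divDiff (S : Finset ℝ) (g : ℝ → ℝ) : ℝ :=
  ∑ x ∈ S, Lagrange.nodalWeight S id x * g x

lemma divDiff_congr {S : Finset ℝ} {g h : ℝ → ℝ} (H : ∀ x ∈ S, g x = h x) :
    divDiff S g = divDiff S h :=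
  Finset.sum_congr rfl fun x hx => by rw [H x hx]

lemma divDiff_eval_eq_zero {S : Finset ℝ} {p : ℝ[X]} (h : p.natDegree + 2 ≤ S.card) :
    divDiff S (fun x => p.eval x) = 0 := by
  have hdeg : p.degree < S.card :=
    lt_of_le_of_lt degree_le_natDegree (by exact_mod_cast (by omega : p.natDegree < S.card))
  have key := Lagrange.coeff_eq_sum (s := S) (v := id) (Set.injOn_id _) hdeg
  rw [coeff_eq_zero_of_natDegree_lt (by omega)] at key
  rw [key]
  refine Finset.sum_congr rfl fun x _ => ?_
  rw [Lagrange.nodalWeight, Finset.prod_inv_distrib, div_eq_inv_mul]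
  rfl

/-- The barycentric formula for the constant interpolant `1`, evaluated at `-x`, yields this value.
-/
lemma divDiff_inv_add {S : Finset ℝ} (hS : ∀ t ∈ S, 0 < t) (hne : S.Nonempty) {x : ℝ}
    (hx : 0 < x) :
    divDiff S (fun t => (x + t)⁻¹) = (-1) ^ (S.card + 1) * ∏ t ∈ S, (x + t)⁻¹ := by
  have hnode : ∀ i ∈ S, -x ≠ id i := fun i hi => by
    have := hS i hi
    simp only [id]
    linarith
  have key := Lagrange.eval_interpolate_not_at_node (s := S) (v := id) (r := 1) hnode
  rw [Lagrange.interpolate_one (Set.injOn_id _) hne, eval_one, Lagrange.eval_nodal] at key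
  have h1 : ∏ i ∈ S, (-x - id i) = (-1) ^ S.card * ∏ t ∈ S, (x + t) := by
    rw [← Finset.prod_const, ← Finset.prod_mul_distrib]
    exact Finset.prod_congr rfl fun i _ => by simp only [id]; ring
  have h2 : ∑ i ∈ S, Lagrange.nodalWeight S id i * (-x - id i)⁻¹ * (1 : ℝ → ℝ) i
      = - divDiff S (fun t => (x + t)⁻¹) := by
    rw [divDiff, ← Finset.sum_neg_distrib]
    refine Finset.sum_congr rfl fun i _ => ?_
    rw [show -x - id i = -(x + i) by simp only [id]; ring, inv_neg]
    simp
  rw [h1, h2] at key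
  have hprod : ∏ t ∈ S, (x + t) ≠ 0 :=
    Finset.prod_ne_zero_iff.2 fun t ht => by have := hS t ht; positivity
  rw [Finset.prod_inv_distrib, ← div_eq_mul_inv, eq_div_iff hprod]
  have hs : ((-1 : ℝ) ^ S.card) * (-1) ^ S.card = 1 := by
    rw [← mul_pow]; norm_num
  rw [pow_succ]
  linear_combination ((-1 : ℝ) ^ S.card) * key
    - (divDiff S (fun t => (x + t)⁻¹) * ∏ t ∈ S, (x + t)) * hs

/-- Dividing `s` by `X + x` leaves `s(-x)/(x + t)` plus a polynomial in `t`. That polynomial, like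
the term `s(t)/x`, has too low a degree to contribute. -/
lemma divDiff_mul_rpowIntegrand {S : Finset ℝ} (hS : ∀ t ∈ S, 0 < t) {s : ℝ[X]}
    (hdeg : s.natDegree + 2 ≤ S.card) (α : ℝ) {x : ℝ} (hx : 0 < x) :
    divDiff S (fun t => s.eval t * Real.rpowIntegrand₀₁ α x t) =
      (-1) ^ S.card * (x ^ α * s.eval (-x) * ∏ t ∈ S, (x + t)⁻¹) := by
  set h := s /ₘ (X - C (-x)) with hh
  have hdiv : s = (X - C (-x)) * h + C (s.eval (-x)) := by
    have := modByMonic_add_div s (X - C (-x))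
    rw [modByMonic_X_sub_C_eq_C_eval] at this
    rw [hh]
    linear_combination -this
  have hne : S.Nonempty := Finset.card_pos.1 (by omega)
  have hhdeg : h.natDegree + 2 ≤ S.card := by
    have : h.natDegree = s.natDegree - 1 := by
      rw [hh, natDegree_divByMonic _ (monic_X_sub_C _), natDegree_X_sub_C]
    omega
  have hsum : divDiff S (fun t => s.eval t * Real.rpowIntegrand₀₁ α x t)
      = x ^ α * x⁻¹ * divDiff S (fun t => s.eval t) - x ^ α * divDiff S (fun t => h.eval t)
        - x ^ α * s.eval (-x) * divDiff S (fun t => (x + t)⁻¹) := by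
    simp only [divDiff, Finset.mul_sum]
    rw [← Finset.sum_sub_distrib, ← Finset.sum_sub_distrib]
    refine Finset.sum_congr rfl fun t ht => ?_
    have hxt : x + t ≠ 0 := by have := hS t ht; positivity
    have he : s.eval t * (x + t)⁻¹ = h.eval t + s.eval (-x) * (x + t)⁻¹ := by
      have := congrArg (eval t) hdiv
      simp only [eval_add, eval_mul, eval_sub, eval_X, eval_C] at this
      rw [this]
      field_simp
      ring
    rw [Real.rpowIntegrand₀₁]
    linear_combination (-(Lagrange.nodalWeight S id t * x ^ α)) * he
  rw [hsum, divDiff_eval_eq_zero hdeg, divDiff_eval_eq_zero hhdeg, divDiff_inv_add hS hne hx]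
  ring

/-- Divided differences of `s(t) t ^ α` have a definite sign if `s` is nonnegative on the
negative half-line and of low degree. -/
theorem divDiff_mul_rpow_pos {α : ℝ} (hα : α ∈ Set.Ioo (0 : ℝ) 1) {S : Finset ℝ}
    (hS : ∀ t ∈ S, 0 < t) {s : ℝ[X]} (hs0 : s ≠ 0) (hdeg : s.natDegree + 2 ≤ S.card)
    (hs : ∀ x, 0 < x → 0 ≤ s.eval (-x)) :
    0 < (-1) ^ S.card * divDiff S (fun t => s.eval t * t ^ α) := by
  set c := (∫ t in Set.Ioi (0 : ℝ), Real.rpowIntegrand₀₁ α t 1)⁻¹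
  have hc : 0 < c := inv_pos.2 (Real.integral_rpowIntegrand₀₁_one_pos hα)
  have hint : ∀ t ∈ S, IntegrableOn (fun x => Lagrange.nodalWeight S id t *
      (s.eval t * Real.rpowIntegrand₀₁ α x t)) (Set.Ioi 0) := fun t ht =>
    ((Real.integrableOn_rpowIntegrand₀₁_Ioi hα (hS t ht).le).const_mul _).const_mul _
  have h1 : divDiff S (fun t => s.eval t * t ^ α) =
      c * ∫ x in Set.Ioi (0 : ℝ), divDiff S (fun t => s.eval t * Real.rpowIntegrand₀₁ α x t) := by
    simp only [divDiff]
    rw [integral_finsetSum _ hint, Finset.mul_sum]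
    refine Finset.sum_congr rfl fun t ht => ?_
    rw [integral_const_mul, integral_const_mul, Real.rpow_eq_const_mul_integral hα (hS t ht).le]
    ring
  set g : ℝ → ℝ := fun x => x ^ α * s.eval (-x) * ∏ t ∈ S, (x + t)⁻¹ with hg
  have hEq : Set.EqOn (fun x => divDiff S (fun t => s.eval t * Real.rpowIntegrand₀₁ α x t))
      (fun x => (-1) ^ S.card * g x) (Set.Ioi 0) :=
    fun x hx => divDiff_mul_rpowIntegrand hS hdeg α hx
  have hsq : ((-1 : ℝ) ^ S.card) * (-1) ^ S.card = 1 := by rw [← mul_pow]; norm_num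
  have hprod : ∀ x, 0 < x → 0 < ∏ t ∈ S, (x + t)⁻¹ := fun x hx =>
    Finset.prod_pos fun t ht => inv_pos.2 (add_pos hx (hS t ht))
  have hgint : IntegrableOn g (Set.Ioi 0) := by
    have : IntegrableOn (fun x => divDiff S
        (fun t => s.eval t * Real.rpowIntegrand₀₁ α x t)) (Set.Ioi 0) :=
      integrable_finsetSum _ hint
    have h2 := (this.congr_fun hEq measurableSet_Ioi).const_mul ((-1) ^ S.card)
    simp only [← mul_assoc, hsq, one_mul] at h2
    exact h2
  have hgpos : 0 < ∫ x in Set.Ioi (0 : ℝ), g x := by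
    rw [setIntegral_pos_iff_support_of_nonneg_ae _ hgint]
    · have hfin : Set.Finite {x : ℝ | s.eval (-x) = 0} := by
        have : {x : ℝ | s.eval (-x) = 0} ⊆ (fun y => -y) '' (s.roots.toFinset : Set ℝ) := by
          intro x hx
          refine ⟨-x, ?_, by simp⟩
          simpa [hs0] using hx
        exact ((Finset.finite_toSet _).image _).subset this
      -- The integrand vanishes only at the finitely many zeros of `s(-x)`, so its integral is
      -- strictly positive.
      have hsub : Set.Ioi (0 : ℝ) \ {x : ℝ | s.eval (-x) = 0} ⊆
          Function.support g ∩ Set.Ioi 0 := by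
        rintro x ⟨hx, hx'⟩
        refine ⟨?_, hx⟩
        have hx0 : (0 : ℝ) < x := hx
        exact mul_ne_zero (mul_ne_zero (Real.rpow_pos_of_pos hx0 _).ne' hx') (hprod x hx0).ne'
      refine lt_of_lt_of_le ?_ (measure_mono hsub)
      rw [measure_sdiff_null (hfin.measure_zero _)]
      simp
    · refine ae_restrict_of_forall_mem measurableSet_Ioi fun x hx => ?_
      have hx0 : (0 : ℝ) < x := hx
      exact mul_nonneg (mul_nonneg (Real.rpow_nonneg hx0.le _) (hs x hx0)) (hprod x hx0).le
  rw [h1, setIntegral_congr_fun measurableSet_Ioi hEq, integral_const_mul]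
  calc (0 : ℝ) < c * ∫ x in Set.Ioi (0 : ℝ), g x := mul_pos hc hgpos
    _ = ((-1 : ℝ) ^ S.card) * (-1) ^ S.card * (c * ∫ x in Set.Ioi (0 : ℝ), g x) := by
        rw [hsq, one_mul]
    _ = _ := by ring

/-- At the nodes `p Q t ^ α` coincides with `p P`, whose degree is too low to be seen. -/
lemma divDiff_comparison {α : ℝ} {S : Finset ℝ} {P Q p : ℝ[X]}
    (hF : ∀ x ∈ S, Q.eval x * x ^ α = P.eval x) (hdeg : (p * P).natDegree + 2 ≤ S.card) :
    divDiff S (fun t => (p * Q).eval t * t ^ α) = 0 := by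
  rw [← divDiff_eval_eq_zero hdeg]
  refine divDiff_congr fun x hx => ?_
  rw [eval_mul, eval_mul, ← hF x hx]
  ring

/-- The sign of `Q(t) (Q(t) t ^ α - P(t))` off the nodes. -/
theorem mul_residual_pos {α : ℝ} (hα : α ∈ Set.Ioo (0 : ℝ) 1) {m : ℕ} {S : Finset ℝ}
    (hS : ∀ t ∈ S, 0 < t) (hcard : S.card = 2 * m + 1) {P Q : ℝ[X]} (hP : P.natDegree ≤ m)
    (hQ : Q.natDegree ≤ m) (hQ0 : Q ≠ 0) (hF : ∀ x ∈ S, Q.eval x * x ^ α = P.eval x)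
    {t : ℝ} (ht : 0 < t) (htS : t ∉ S) :
    0 < (∏ x ∈ S, (t - x)) * (Q.eval t * (Q.eval t * t ^ α - P.eval t)) := by
  have hTcard : (insert t S).card = 2 * m + 2 := by rw [Finset.card_insert_of_notMem htS, hcard]
  have hT : ∀ x ∈ insert t S, 0 < x := by
    intro x hx
    rcases Finset.mem_insert.1 hx with rfl | hx
    exacts [ht, hS x hx]
  have key := divDiff_mul_rpow_pos hα hT (s := Q * Q) (mul_ne_zero hQ0 hQ0)
    (by have := natDegree_mul_le (p := Q) (q := Q); omega)
    (fun x _ => by rw [eval_mul]; exact mul_self_nonneg _)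
  rw [hTcard, show 2 * m + 2 = 2 * (m + 1) by ring, pow_mul, neg_one_sq, one_pow, one_mul] at key
  have hz : divDiff (insert t S) (fun x => (Q * P).eval x) = 0 :=
    divDiff_eval_eq_zero (by have := natDegree_mul_le (p := Q) (q := P); omega)
  -- After subtracting the vanishing divided difference of `Q P`, the summand `Q (Q x ^ α - P)` is
  -- zero on `S`, so only the node `t` remains.
  have h1 : divDiff (insert t S) (fun x => (Q * Q).eval x * x ^ α) =
      (∏ x ∈ S, (t - x)⁻¹) * (Q.eval t * (Q.eval t * t ^ α - P.eval t)) := by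
    rw [← sub_zero (divDiff _ _), ← hz, divDiff, divDiff, ← Finset.sum_sub_distrib,
      Finset.sum_insert htS, Finset.sum_eq_zero, add_zero, Lagrange.nodalWeight,
      Finset.erase_insert htS]
    · simp only [id, eval_mul]
      ring
    · intro x hx
      simp only [eval_mul]
      rw [← hF x hx]
      ring
  rw [h1, Finset.prod_inv_distrib] at key
  have hne : ∏ x ∈ S, (t - x) ≠ 0 :=
    Finset.prod_ne_zero_iff.2 fun x hx => sub_ne_zero.2 fun h => htS (h ▸ hx)
  have hsq : 0 < (∏ x ∈ S, (t - x)) ^ 2 := by positivity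
  have h2 := mul_pos hsq key
  rwa [sq, mul_assoc, ← mul_assoc (∏ x ∈ S, (t - x)) (∏ x ∈ S, (t - x))⁻¹, mul_inv_cancel₀ hne,
    one_mul] at h2

/-! ### Roots, residues and monotonicity of the interpolant. -/

section Interpolant

variable {α : ℝ} {m : ℕ} {S : Finset ℝ} {P Q : ℝ[X]}

/-- The positivity theorem contradicts `divDiff_comparison`. Each structural fact about `Q` comes
from a multiplier `p` that would make `p Q` nonnegative on the negative half-line. -/
lemma not_nonneg_mul (hα : α ∈ Set.Ioo (0 : ℝ) 1) (hS : ∀ t ∈ S, 0 < t)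
    (hcard : S.card = 2 * m + 1) (hP : P.natDegree ≤ m) (hQ : Q.natDegree ≤ m) (hQ0 : Q ≠ 0)
    (hF : ∀ x ∈ S, Q.eval x * x ^ α = P.eval x) {p : ℝ[X]} (hp0 : p ≠ 0)
    (hp : p.natDegree + 1 ≤ m) : ¬ ∀ x, 0 < x → 0 ≤ (p * Q).eval (-x) := by
  intro h
  have := divDiff_mul_rpow_pos hα hS (mul_ne_zero hp0 hQ0)
    (by have := natDegree_mul_le (p := p) (q := Q); omega) h
  rw [divDiff_comparison hF (by have := natDegree_mul_le (p := p) (q := P); omega)] at this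
  simp at this

/-- The denominator of the interpolant has full degree. -/
lemma natDegree_denom_eq (hα : α ∈ Set.Ioo (0 : ℝ) 1) (hS : ∀ t ∈ S, 0 < t)
    (hcard : S.card = 2 * m + 1) (hP : P.natDegree ≤ m) (hQ : Q.natDegree ≤ m) (hQ0 : Q ≠ 0)
    (hF : ∀ x ∈ S, Q.eval x * x ^ α = P.eval x) : Q.natDegree = m := by
  by_contra hne
  -- If the degree were smaller, `p = Q` would be admissible and `p Q` a square.
  refine not_nonneg_mul hα hS hcard hP hQ hQ0 hF hQ0 (by omega) fun x _ => ?_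
  rw [eval_mul]
  exact mul_self_nonneg _

lemma natDegree_eq_add_of_mul_eq {p q r : ℝ[X]} (hr : r ≠ 0) (h : r = p * q) :
    r.natDegree = p.natDegree + q.natDegree := by
  rw [h] at hr
  rw [h, natDegree_mul (left_ne_zero_of_mul hr) (right_ne_zero_of_mul hr)]

/-- The denominator of the interpolant splits over `ℝ`. -/
lemma card_roots_denom_eq (hα : α ∈ Set.Ioo (0 : ℝ) 1) (hS : ∀ t ∈ S, 0 < t)
    (hcard : S.card = 2 * m + 1) (hP : P.natDegree ≤ m) (hQ : Q.natDegree ≤ m) (hQ0 : Q ≠ 0)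
    (hF : ∀ x ∈ S, Q.eval x * x ^ α = P.eval x) : Multiset.card Q.roots = Q.natDegree := by
  obtain ⟨q, hq, hqd, hqr⟩ := exists_prod_multiset_X_sub_C_mul Q
  by_contra hne
  have hqd0 : 0 < q.natDegree := by omega
  have hq0 : q ≠ 0 := fun h => by simp [h] at hqd0
  obtain ⟨z, hz⟩ : ∃ z : ℂ, aeval z q = 0 :=
    IsAlgClosed.exists_aeval_eq_zero _ q (natDegree_pos_iff_degree_pos.1 hqd0).ne'
  have him : z.im ≠ 0 := by
    intro him
    have hzr : z = (algebraMap ℝ ℂ) z.re := by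
      apply Complex.ext <;> simp [him]
    rw [hzr, aeval_algebraMap_apply] at hz
    have hroot : z.re ∈ q.roots := by
      rw [mem_roots hq0, IsRoot.def, ← coe_aeval_eq_eval]
      simpa using hz
    simp [hqr] at hroot
  -- A nonreal root gives a real quadratic factor `g ≥ 0`. With `p = R` the cofactor, `p Q = g R²`.
  obtain ⟨R, hR⟩ := (quadratic_dvd_of_aeval_eq_zero_im_ne_zero q hz him).trans
    ((dvd_mul_left q _).trans hq.dvd)
  set g : ℝ[X] := X ^ 2 - C (2 * z.re) * X + C (‖z‖ ^ 2) with hg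
  have hgdeg : g.natDegree = 2 := by
    rw [hg]
    compute_degree!
  have hR0 : R ≠ 0 := fun h => hQ0 (by rw [hR, h, mul_zero])
  have hdeg := natDegree_eq_add_of_mul_eq hQ0 hR
  refine not_nonneg_mul hα hS hcard hP hQ hQ0 hF hR0 (by omega) fun x _ => ?_
  have hgx : 0 ≤ g.eval (-x) := by
    have : g.eval (-x) = (x + z.re) ^ 2 + z.im ^ 2 := by
      rw [hg, Complex.sq_norm, Complex.normSq_apply]
      simp only [eval_add, eval_sub, eval_mul, eval_pow, eval_X, eval_C]
      ring
    rw [this]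
    positivity
  rw [hR, eval_mul, eval_mul]
  nlinarith [mul_nonneg hgx (mul_self_nonneg (R.eval (-x)))]

/-- For a root `a ≥ 0` and `Q = (X - a) R`, the multiplier `-R` gives `(x + a) R(-x)² ≥ 0` at `-x`.
-/
lemma roots_denom_neg (hα : α ∈ Set.Ioo (0 : ℝ) 1) (hS : ∀ t ∈ S, 0 < t)
    (hcard : S.card = 2 * m + 1) (hP : P.natDegree ≤ m) (hQ : Q.natDegree ≤ m) (hQ0 : Q ≠ 0)
    (hF : ∀ x ∈ S, Q.eval x * x ^ α = P.eval x) {a : ℝ} (ha : a ∈ Q.roots) : a < 0 := by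
  by_contra hle
  push Not at hle
  obtain ⟨R, hR⟩ := dvd_iff_isRoot.2 ((mem_roots hQ0).1 ha)
  have hR0 : R ≠ 0 := fun h => hQ0 (by rw [hR, h, mul_zero])
  have hdeg := natDegree_eq_add_of_mul_eq hQ0 hR
  rw [natDegree_X_sub_C] at hdeg
  refine not_nonneg_mul hα hS hcard hP hQ hQ0 hF (neg_ne_zero.2 hR0)
    (by rw [natDegree_neg]; omega) fun x hx => ?_
  rw [hR]
  simp only [eval_mul, eval_neg, eval_sub, eval_X, eval_C]
  nlinarith [mul_nonneg (add_nonneg hx.le hle) (mul_self_nonneg (R.eval (-x)))]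

/-- For a double root and `Q = (X - a)² R`, the multiplier `R` gives the square of `(X - a) R`. -/
lemma roots_denom_nodup (hα : α ∈ Set.Ioo (0 : ℝ) 1) (hS : ∀ t ∈ S, 0 < t)
    (hcard : S.card = 2 * m + 1) (hP : P.natDegree ≤ m) (hQ : Q.natDegree ≤ m) (hQ0 : Q ≠ 0)
    (hF : ∀ x ∈ S, Q.eval x * x ^ α = P.eval x) : Q.roots.Nodup := by
  refine Multiset.nodup_iff_count_le_one.2 fun a => ?_
  by_contra hlt
  push Not at hlt
  rw [count_roots] at hlt
  obtain ⟨R, hR⟩ := (pow_dvd_pow (X - C a) hlt).trans (pow_rootMultiplicity_dvd Q a)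
  have hR0 : R ≠ 0 := fun h => hQ0 (by rw [hR, h, mul_zero])
  have hdeg := natDegree_eq_add_of_mul_eq hQ0 hR
  rw [natDegree_pow, natDegree_X_sub_C] at hdeg
  refine not_nonneg_mul hα hS hcard hP hQ hQ0 hF hR0 (by omega) fun x _ => ?_
  rw [hR]
  simp only [eval_mul, eval_pow, eval_sub, eval_X, eval_C]
  have : R.eval (-x) * ((-x - a) ^ Nat.succ 1 * R.eval (-x)) = ((-x - a) * R.eval (-x)) ^ 2 := by
    rw [Nat.succ_eq_add_one]; ring
  rw [this]
  positivity

/-- The sign of the residues of the interpolant. -/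
lemma residue_neg (hα : α ∈ Set.Ioo (0 : ℝ) 1) (hS : ∀ t ∈ S, 0 < t)
    (hcard : S.card = 2 * m + 1) (hP : P.natDegree ≤ m) (hQ : Q.natDegree ≤ m) (hQ0 : Q ≠ 0)
    (hF : ∀ x ∈ S, Q.eval x * x ^ α = P.eval x) {a : ℝ} (ha : a < 0) {R : ℝ[X]}
    (hR : Q = (X - C a) * R) : P.eval a * R.eval a < 0 := by
  have hR0 : R ≠ 0 := fun h => hQ0 (by rw [hR, h, mul_zero])
  have hdeg := natDegree_eq_add_of_mul_eq hQ0 hR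
  rw [natDegree_X_sub_C] at hdeg
  have hRR := natDegree_mul_le (p := R) (q := R)
  have hRP := natDegree_mul_le (p := R) (q := P)
  have key := divDiff_mul_rpow_pos hα hS (s := R * R) (mul_ne_zero hR0 hR0) (by omega)
    (fun x _ => by rw [eval_mul]; exact mul_self_nonneg _)
  set h := (R * P) /ₘ (X - C a) with hh
  have hdiv : R * P = (X - C a) * h + C ((R * P).eval a) := by
    have := modByMonic_add_div (R * P) (X - C a)
    rw [modByMonic_X_sub_C_eq_C_eval] at this
    rw [hh]
    linear_combination -this
  have hhdeg : h.natDegree + 2 ≤ S.card := by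
    have : h.natDegree = (R * P).natDegree - 1 := by
      rw [hh, natDegree_divByMonic _ (monic_X_sub_C _), natDegree_X_sub_C]
    omega
  -- At the nodes `R² t ^ α = R P / (t - a)`. The left side has negative divided difference because
  -- there are an odd number of nodes, while that of `1/(t - a)` is positive.
  have h1 : divDiff S (fun t => (R * R).eval t * t ^ α) =
      divDiff S (fun t => h.eval t) + (R * P).eval a * divDiff S (fun t => (-a + t)⁻¹) := by
    simp only [divDiff, Finset.mul_sum]
    rw [← Finset.sum_add_distrib]
    refine Finset.sum_congr rfl fun t ht => ?_
    have hta : -a + t ≠ 0 := by have := hS t ht; linarith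
    have he := congrArg (eval t) hdiv
    have hf := hF t ht
    rw [hR] at hf
    simp only [eval_add, eval_mul, eval_sub, eval_X, eval_C] at he hf
    have : (R * R).eval t * t ^ α = h.eval t + (R * P).eval a * (-a + t)⁻¹ := by
      rw [eval_mul, eval_mul]
      field_simp
      linear_combination he + (R.eval t) * hf
    rw [this]
    ring
  have hne : S.Nonempty := Finset.card_pos.1 (by omega)
  rw [h1, divDiff_eval_eq_zero hhdeg, divDiff_inv_add hS hne (neg_pos.2 ha), hcard,
    Odd.neg_one_pow ⟨m, rfl⟩, Even.neg_one_pow ⟨m + 1, by ring⟩, zero_add, one_mul, eval_mul] at key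
  have hprod : 0 < ∏ t ∈ S, (-a + t)⁻¹ :=
    Finset.prod_pos fun t ht => inv_pos.2 (add_pos (neg_pos.2 ha) (hS t ht))
  nlinarith

/-- A monic denominator of the interpolant is a product of distinct linear factors. -/
lemma denom_eq_nodal (hα : α ∈ Set.Ioo (0 : ℝ) 1) (hS : ∀ t ∈ S, 0 < t)
    (hcard : S.card = 2 * m + 1) (hP : P.natDegree ≤ m) (hQ : Q.natDegree ≤ m) (hQm : Q.Monic)
    (hF : ∀ x ∈ S, Q.eval x * x ^ α = P.eval x) :
    Q = Lagrange.nodal Q.roots.toFinset id := by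
  have hnd := roots_denom_nodup hα hS hcard hP hQ hQm.ne_zero hF
  have h := prod_multiset_X_sub_C_of_monic_of_roots_card_eq hQm
    (card_roots_denom_eq hα hS hcard hP hQ hQm.ne_zero hF)
  rw [Lagrange.nodal, Finset.prod, Multiset.toFinset_val, Multiset.dedup_eq_self.2 hnd]
  exact h.symm

lemma denom_pos (hα : α ∈ Set.Ioo (0 : ℝ) 1) (hS : ∀ t ∈ S, 0 < t)
    (hcard : S.card = 2 * m + 1) (hP : P.natDegree ≤ m) (hQ : Q.natDegree ≤ m) (hQm : Q.Monic)
    (hF : ∀ x ∈ S, Q.eval x * x ^ α = P.eval x) {t : ℝ} (ht : 0 ≤ t) : 0 < Q.eval t := by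
  rw [denom_eq_nodal hα hS hcard hP hQ hQm hF, Lagrange.eval_nodal]
  refine Finset.prod_pos fun a ha => ?_
  have := roots_denom_neg hα hS hcard hP hQ hQm.ne_zero hF (Multiset.mem_toFinset.1 ha)
  simp only [id]
  linarith

/-- The interpolant is strictly increasing on `[0, ∞)`. -/
theorem interpolant_strictMono (hα : α ∈ Set.Ioo (0 : ℝ) 1) (hS : ∀ t ∈ S, 0 < t) (hm : 1 ≤ m)
    (hcard : S.card = 2 * m + 1) (hP : P.natDegree ≤ m) (hQ : Q.natDegree ≤ m) (hQm : Q.Monic)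
    (hF : ∀ x ∈ S, Q.eval x * x ^ α = P.eval x) {u t : ℝ} (hu : 0 ≤ u) (hut : u < t) :
    P.eval u / Q.eval u < P.eval t / Q.eval t := by
  have hnodal := denom_eq_nodal hα hS hcard hP hQ hQm hF
  have hQdeg := natDegree_denom_eq hα hS hcard hP hQ hQm.ne_zero hF
  set A := Q.roots.toFinset with hA
  have hAneg : ∀ a ∈ A, a < 0 := fun a ha =>
    roots_denom_neg hα hS hcard hP hQ hQm.ne_zero hF (Multiset.mem_toFinset.1 ha)
  have hAcard : A.card = m := by
    rw [← hQdeg, hnodal, Lagrange.natDegree_nodal]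
  have hQroot : ∀ a ∈ A, Q.eval a = 0 := fun a ha => by
    rw [hnodal]
    exact Lagrange.eval_nodal_at_node (v := id) ha
  -- Subtracting the value at infinity makes the fraction proper, so interpolation at the poles is
  -- its partial fraction expansion.
  have hdeg : (P - C (P.coeff m) * Q).degree < A.card := by
    rw [hAcard, degree_lt_iff_coeff_zero]
    intro n hn
    rw [coeff_sub, coeff_C_mul]
    rcases hn.eq_or_lt with rfl | hn
    · have : Q.coeff m = 1 := by rw [← hQdeg]; exact hQm.coeff_natDegree
      rw [this]; ring
    · rw [coeff_eq_zero_of_natDegree_lt (hP.trans_lt hn),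
        coeff_eq_zero_of_natDegree_lt (hQ.trans_lt hn)]
      ring
  have hinterp := Lagrange.eq_interpolate_of_eval_eq (s := A) (v := id) (r := fun a => P.eval a)
    (Set.injOn_id _) hdeg (fun a ha => by simp [hQroot a ha])
  have hpf : ∀ x, 0 ≤ x → P.eval x / Q.eval x =
      P.coeff m + ∑ a ∈ A, Lagrange.nodalWeight A id a * P.eval a * (x - a)⁻¹ := by
    intro x hx
    have hne : ∀ a ∈ A, x ≠ id a := fun a ha => by
      have := hAneg a ha
      simp only [id]
      linarith
    have h1 := congrArg (eval x) hinterp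
    rw [Lagrange.eval_interpolate_not_at_node _ hne, ← hnodal] at h1
    have hQx := denom_pos hα hS hcard hP hQ hQm hF hx
    rw [div_eq_iff hQx.ne']
    simp only [eval_sub, eval_mul, eval_C] at h1
    have h2 : ∑ a ∈ A, Lagrange.nodalWeight A id a * P.eval a * (x - a)⁻¹ =
        ∑ a ∈ A, Lagrange.nodalWeight A id a * (x - id a)⁻¹ * P.eval a :=
      Finset.sum_congr rfl fun a _ => by simp only [id]; ring
    rw [h2]
    linear_combination h1
  -- These are the residues `P(a)/Q'(a)`. When negative, each term `residue/(x - a)` increases to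
  -- the right of its pole.
  have hw : ∀ a ∈ A, Lagrange.nodalWeight A id a * P.eval a < 0 := by
    intro a ha
    have hQa : Q = (X - C a) * Lagrange.nodal (A.erase a) id := by
      conv_lhs => rw [hnodal]
      exact Lagrange.nodal_eq_mul_nodal_erase (v := id) ha
    have hres := residue_neg hα hS hcard hP hQ hQm.ne_zero hF (hAneg a ha) hQa
    rw [Lagrange.nodalWeight_eq_eval_nodal_erase_inv]
    simp only [id] at hres ⊢
    have hne : (Lagrange.nodal (A.erase a) id).eval a ≠ 0 := right_ne_zero_of_mul hres.ne
    have hsq : 0 < ((Lagrange.nodal (A.erase a) id).eval a)⁻¹ ^ 2 := by positivity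
    have h2 := mul_neg_of_pos_of_neg hsq hres
    rwa [mul_comm (P.eval a), sq, mul_assoc, inv_mul_cancel_left₀ hne] at h2
  rw [hpf u hu, hpf t (hu.trans hut.le)]
  have hne : A.Nonempty := Finset.card_pos.1 (by omega)
  refine (add_lt_add_iff_left _).2 (Finset.sum_lt_sum_of_nonempty hne fun a ha => ?_)
  refine mul_lt_mul_of_neg_left ?_ (hw a ha)
  have := hAneg a ha
  exact inv_strictAnti₀ (by linarith) (by linarith)

end Interpolant

/-! ### The approximation error with denominators cleared. -/

/-- `|P / Q - t ^ α| ≤ c` on `[0,1]`, with denominators cleared. -/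
def ApproxWithin (α c : ℝ) (P Q : ℝ[X]) : Prop :=
  ∀ t ∈ Set.Icc (0 : ℝ) 1, |P.eval t - t ^ α * Q.eval t| ≤ c * |Q.eval t|

/-- The quotient of two polynomials as a rational function. -/
noncomputable def quot (P Q : ℝ[X]) : RatFunc ℝ :=
  algebraMap ℝ[X] (RatFunc ℝ) P / algebraMap ℝ[X] (RatFunc ℝ) Q

/-- The reduced denominator divides `Q`, so cancelling common factors does not change the value
where `Q` is nonzero. -/
lemma val_quot {P Q : ℝ[X]} {t : ℝ} (hQt : Q.eval t ≠ 0) :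
    val (quot P Q) t = P.eval t / Q.eval t := by
  have hQ : Q ≠ 0 := fun h => hQt (by simp [h])
  set r := quot P Q with hr
  have hd0 : r.denom ≠ 0 := r.denom_ne_zero
  have hid : r.num * Q = P * r.denom := by
    apply RatFunc.algebraMap_injective ℝ
    have h1 := RatFunc.num_div_denom r
    have hq : algebraMap ℝ[X] (RatFunc ℝ) Q ≠ 0 := RatFunc.algebraMap_ne_zero hQ
    have hd : algebraMap ℝ[X] (RatFunc ℝ) r.denom ≠ 0 := RatFunc.algebraMap_ne_zero hd0
    rw [map_mul, map_mul]
    rw [← div_eq_div_iff hd hq, h1, hr, quot]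
  have hdt : r.denom.eval t ≠ 0 := by
    obtain ⟨g, hg⟩ := RatFunc.denom_div_dvd P Q
    intro h
    apply hQt
    rw [hg, eval_mul]
    change r.denom.eval t * _ = 0
    rw [h, zero_mul]
  have he := congrArg (eval t) hid
  rw [eval_mul, eval_mul] at he
  rw [val, RatFunc.eval, eval₂_id, eval₂_id, div_eq_div_iff hdt hQt, he]

lemma val_eq (r : RatFunc ℝ) (t : ℝ) : val r t = r.num.eval t / r.denom.eval t := by
  rw [val, RatFunc.eval, eval₂_id, eval₂_id]

lemma continuous_residual {α : ℝ} (hα : 0 < α) (P Q : ℝ[X]) :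
    Continuous fun t : ℝ => P.eval t - t ^ α * Q.eval t :=
  P.continuous.sub ((continuous_id.rpow_const fun _ => Or.inr hα.le).mul Q.continuous)

lemma supError_le_iff {α : ℝ} (hα : 0 < α) {P Q : ℝ[X]} (hQ : Q ≠ 0) {c : ℝ} (hc : 0 ≤ c) :
    supError (1 - α) (quot P Q) ≤ ENNReal.ofReal c ↔ ApproxWithin α c P Q := by
  have hroots : ∀ᵐ t : ℝ, Q.eval t ≠ 0 := by
    have hfin : Set.Finite {t : ℝ | Q.eval t = 0} :=
      (Finset.finite_toSet Q.roots.toFinset).subset fun t ht => by simpa [hQ] using ht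
    exact compl_mem_ae_iff.2 (hfin.measure_zero _)
  have habs : ∀ t : ℝ, Q.eval t ≠ 0 →
      (|t ^ (1 - (1 - α)) - val (quot P Q) t| ≤ c ↔
        |P.eval t - t ^ α * Q.eval t| ≤ c * |Q.eval t|) := by
    intro t ht
    rw [val_quot ht, sub_sub_cancel, abs_sub_comm, div_sub' ht, abs_div,
      div_le_iff₀ (abs_pos.2 ht), mul_comm (Q.eval t)]
  rw [supError, eLpNorm_exponent_top]
  constructor
  · intro h
    have hae : ∀ᵐ t ∂(volume.restrict (Set.Ioo (0 : ℝ) 1)),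
        |P.eval t - t ^ α * Q.eval t| ≤ c * |Q.eval t| := by
      filter_upwards [ae_le_eLpNormEssSup (μ := volume.restrict (Set.Ioo (0 : ℝ) 1))
        (f := fun t : ℝ => t ^ (1 - (1 - α)) - val (quot P Q) t),
        ae_restrict_of_ae hroots] with t ht hQt
      rw [← habs t hQt]
      have := ht.trans h
      rwa [Real.enorm_eq_ofReal_abs, ENNReal.ofReal_le_ofReal_iff hc] at this
    -- The violation set is open and null, hence empty. Continuity then extends the bound to both
    -- endpoints and to the roots of `Q`.
    set U : Set ℝ := {t | c * |Q.eval t| < |P.eval t - t ^ α * Q.eval t|} ∩ Set.Ioo 0 1 with hU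
    have hopen : IsOpen U :=
      (isOpen_lt (continuous_const.mul Q.continuous.abs)
        (continuous_residual hα P Q).abs).inter isOpen_Ioo
    have hnull : volume U = 0 := by
      rw [ae_restrict_iff' measurableSet_Ioo] at hae
      refine measure_mono_null ?_ hae
      rintro t ⟨ht, ht'⟩ h
      exact absurd (h ht') (not_le.2 ht)
    have hempty : U = ∅ := hopen.eq_empty_of_measure_zero hnull
    have hclosed : IsClosed {t | |P.eval t - t ^ α * Q.eval t| ≤ c * |Q.eval t|} :=
      isClosed_le (continuous_residual hα P Q).abs (continuous_const.mul Q.continuous.abs)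
    have hsub : Set.Ioo (0 : ℝ) 1 ⊆ {t | |P.eval t - t ^ α * Q.eval t| ≤ c * |Q.eval t|} := by
      intro t ht
      by_contra hcon
      have hcon' : c * |Q.eval t| < |P.eval t - t ^ α * Q.eval t| := not_le.1 hcon
      have : t ∈ U := ⟨hcon', ht⟩
      rw [hempty] at this
      exact this
    intro t ht
    rw [← closure_Ioo (zero_ne_one' ℝ)] at ht
    exact closure_minimal hsub hclosed ht
  · intro h
    refine eLpNormEssSup_le_of_ae_bound ?_
    filter_upwards [ae_restrict_mem measurableSet_Ioo, ae_restrict_of_ae hroots] with t ht hQt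
    rw [Real.norm_eq_abs, habs t hQt]
    exact h t ⟨ht.1.le, ht.2.le⟩

lemma quot_mem_ratClass {k : ℕ} {P Q : ℝ[X]} (hP : P.natDegree ≤ k) (hQ : Q.natDegree ≤ k)
    (hQ0 : Q ≠ 0) : quot P Q ∈ ratClass k k := by
  have hl : Q.leadingCoeff⁻¹ ≠ 0 := inv_ne_zero (leadingCoeff_ne_zero.2 hQ0)
  refine ⟨C Q.leadingCoeff⁻¹ * P, C Q.leadingCoeff⁻¹ * Q,
    (natDegree_C_mul_le _ _).trans hP, (natDegree_C_mul_le _ _).trans hQ, ?_, ?_⟩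
  · rw [mul_comm]
    exact monic_mul_leadingCoeff_inv hQ0
  · rw [map_mul, map_mul, mul_div_mul_left _ _ (RatFunc.algebraMap_ne_zero (C_ne_zero.2 hl)), quot]

lemma supError_zero_le {α : ℝ} (hα : 0 < α) : supError (1 - α) (quot 0 1) ≤ ENNReal.ofReal 1 := by
  rw [supError_le_iff hα one_ne_zero zero_le_one]
  intro t ht
  simp only [eval_zero, eval_one, zero_sub, mul_one, abs_neg, abs_one]
  rw [abs_of_nonneg (Real.rpow_nonneg ht.1 _)]
  exact Real.rpow_le_one ht.1 ht.2 hα.le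

/-! ### Existence of best approximations by compactness. -/

/-- The interpolation nodes `i / (k + 1)`, `0 ≤ i ≤ k`. -/
noncomputable def unitNode (k : ℕ) (i : Fin (k + 1)) : ℝ := (i : ℝ) / (k + 1)

lemma unitNode_injective (k : ℕ) : Function.Injective (unitNode k) := by
  intro i j h
  have hk : (k : ℝ) + 1 ≠ 0 := by positivity
  simp only [unitNode] at h
  rw [div_left_inj' hk] at h
  exact Fin.ext (by exact_mod_cast h)

lemma unitNode_mem (k : ℕ) (i : Fin (k + 1)) : unitNode k i ∈ Set.Icc (0 : ℝ) 1 := by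
  have hk : (0 : ℝ) < k + 1 := by positivity
  refine ⟨by unfold unitNode; positivity, ?_⟩
  rw [unitNode, div_le_one hk]
  exact_mod_cast i.isLt.le

/-- The polynomial of degree at most `k` with given values at the nodes. -/
noncomputable def interp (k : ℕ) : (Fin (k + 1) → ℝ) →ₗ[ℝ] ℝ[X] :=
  Lagrange.interpolate Finset.univ (unitNode k)

lemma interp_eval_node {k : ℕ} (u : Fin (k + 1) → ℝ) (i : Fin (k + 1)) :
    (interp k u).eval (unitNode k i) = u i :=
  Lagrange.eval_interpolate_at_node _ (unitNode_injective k).injOn (Finset.mem_univ i)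

lemma natDegree_interp_le {k : ℕ} (u : Fin (k + 1) → ℝ) : (interp k u).natDegree ≤ k := by
  have h := Lagrange.degree_interpolate_le (s := Finset.univ) u (unitNode_injective k).injOn
  rw [Finset.card_univ, Fintype.card_fin, add_tsub_cancel_right] at h
  exact natDegree_le_of_degree_le h

lemma interp_eq {k : ℕ} {P : ℝ[X]} (hP : P.natDegree ≤ k) :
    interp k (fun i => P.eval (unitNode k i)) = P := by
  refine (Lagrange.eq_interpolate (unitNode_injective k).injOn ?_).symm
  refine lt_of_le_of_lt (degree_le_of_natDegree_le hP) ?_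
  rw [Finset.card_univ, Fintype.card_fin]
  exact_mod_cast Nat.lt_succ_self k

lemma continuous_interp_eval (k : ℕ) (t : ℝ) :
    Continuous fun u : Fin (k + 1) → ℝ => (interp k u).eval t := by
  have : (fun u : Fin (k + 1) → ℝ => (interp k u).eval t) =
      fun u => ∑ i, u i * (Lagrange.basis Finset.univ (unitNode k) i).eval t := by
    ext u
    simp [interp, Lagrange.interpolate_apply, eval_finsetSum]
  rw [this]
  fun_prop

lemma ApproxWithin.smul {α c : ℝ} {P Q : ℝ[X]} (h : ApproxWithin α c P Q) (a : ℝ) :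
    ApproxWithin α c (a • P) (a • Q) := by
  intro t ht
  have h1 := mul_le_mul_of_nonneg_left (h t ht) (abs_nonneg a)
  rw [← abs_mul] at h1
  simp only [eval_smul, smul_eq_mul, abs_mul a]
  calc _ = |a * (P.eval t - t ^ α * Q.eval t)| := by ring_nf
    _ ≤ _ := h1
    _ = _ := by ring

/-- Normalized pairs of numerators and denominators, given by their values at the nodes, whose
quotient approximates `t ^ α` within `c`. -/
def approxPairs (α : ℝ) (k : ℕ) (c : ℝ) : Set ((Fin (k + 1) → ℝ) × (Fin (k + 1) → ℝ)) :=
  {p | ‖p.2‖ = 1 ∧ ApproxWithin α c (interp k p.1) (interp k p.2)}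

lemma isClosed_approxPairs (α : ℝ) (k : ℕ) (c : ℝ) : IsClosed (approxPairs α k c) := by
  have hset : approxPairs α k c = {p | ‖p.2‖ = 1} ∩ ⋂ t ∈ Set.Icc (0 : ℝ) 1,
      {p | |(interp k p.1).eval t - t ^ α * (interp k p.2).eval t| ≤
        c * |(interp k p.2).eval t|} := by
    ext p
    simp [approxPairs, ApproxWithin]
  rw [hset]
  refine (isClosed_eq (by fun_prop) continuous_const).inter ?_
  refine isClosed_iInter fun t => isClosed_iInter fun _ => ?_
  have h1 := (continuous_interp_eval k t).comp
    (continuous_fst (X := Fin (k + 1) → ℝ) (Y := Fin (k + 1) → ℝ))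
  have h2 := (continuous_interp_eval k t).comp
    (continuous_snd (X := Fin (k + 1) → ℝ) (Y := Fin (k + 1) → ℝ))
  exact isClosed_le (h1.sub (continuous_const.mul h2)).abs (continuous_const.mul h2.abs)

/-- Normalizing the denominator bounds the numerator at each node by `c |w i| + |w i| ≤ c + 1`. -/
lemma isCompact_approxPairs {α : ℝ} (hα : 0 < α) (k : ℕ) {c : ℝ} (hc : 0 ≤ c) :
    IsCompact (approxPairs α k c) := by
  refine (isCompact_closedBall 0 (c + 1)).of_isClosed_subset (isClosed_approxPairs α k c) ?_
  rintro ⟨u, w⟩ ⟨hw, h⟩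
  simp only at hw h
  rw [mem_closedBall_zero_iff, Prod.norm_def, max_le_iff]
  refine ⟨(pi_norm_le_iff_of_nonneg (by linarith)).2 fun i => ?_, by rw [hw]; linarith⟩
  have hi := h _ (unitNode_mem k i)
  rw [interp_eval_node, interp_eval_node] at hi
  have hwi : |w i| ≤ 1 := hw ▸ norm_le_pi_norm w i
  have hp0 := Real.rpow_nonneg (unitNode_mem k i).1 α
  have hp1 := Real.rpow_le_one (unitNode_mem k i).1 (unitNode_mem k i).2 hα.le
  have h3 : |unitNode k i ^ α * w i| ≤ 1 := by
    rw [abs_mul, abs_of_nonneg hp0]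
    nlinarith [abs_nonneg (w i)]
  have h4 := abs_sub_abs_le_abs_sub (u i) (unitNode k i ^ α * w i)
  rw [Real.norm_eq_abs]
  nlinarith

lemma ApproxWithin.mono {α c d : ℝ} {P Q : ℝ[X]} (h : ApproxWithin α c P Q) (hcd : c ≤ d) :
    ApproxWithin α d P Q := fun t ht =>
  (h t ht).trans (mul_le_mul_of_nonneg_right hcd (abs_nonneg _))

/-- Existence of best rational approximations. -/
theorem exists_isBURA {α : ℝ} (hα : 0 < α) (k : ℕ) : ∃ r, IsBURA (1 - α) k k r := by
  set I : ENNReal := ⨅ r ∈ ratClass k k, supError (1 - α) r with hI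
  have h01 : quot 0 1 ∈ ratClass k k :=
    quot_mem_ratClass (by simp) (by simp) one_ne_zero
  have hItop : I ≠ ⊤ := by
    refine ne_top_of_le_ne_top ENNReal.ofReal_ne_top ((iInf₂_le _ h01).trans (supError_zero_le hα))
  -- These levels decrease to the infimum, and a point common to the nested compact sets attains it.
  -- The normalization keeps the limiting denominator nonzero.
  set c : ℕ → ℝ := fun n => I.toReal + 1 / ((n : ℝ) + 1) with hc
  have hcpos : ∀ n, 0 ≤ c n := fun n => by
    have : 0 ≤ I.toReal := ENNReal.toReal_nonneg
    simp only [hc]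
    positivity
  have hne : ∀ n, (approxPairs α k (c n)).Nonempty := by
    intro n
    have hlt : I < ENNReal.ofReal (c n) := by
      rw [← ENNReal.ofReal_toReal hItop, ENNReal.ofReal_lt_ofReal_iff_of_nonneg ENNReal.toReal_nonneg]
      have : (0 : ℝ) < 1 / ((n : ℝ) + 1) := by positivity
      simp only [hc]
      linarith
    obtain ⟨s, hs, hlt⟩ : ∃ s ∈ ratClass k k, supError (1 - α) s < ENNReal.ofReal (c n) := by
      simpa [hI, iInf_lt_iff] using hlt
    obtain ⟨P, Q, hP, hQ, hQm, rfl⟩ := hs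
    have happ := (supError_le_iff hα hQm.ne_zero (hcpos n)).1 hlt.le
    set u : Fin (k + 1) → ℝ := fun i => P.eval (unitNode k i) with hu
    set w : Fin (k + 1) → ℝ := fun i => Q.eval (unitNode k i) with hw
    have hPu : interp k u = P := interp_eq hP
    have hQw : interp k w = Q := interp_eq hQ
    have hw0 : w ≠ 0 := fun h => hQm.ne_zero (by rw [← hQw, h, map_zero])
    refine ⟨(‖w‖⁻¹ • u, ‖w‖⁻¹ • w), ?_, ?_⟩
    · exact norm_smul_inv_norm (𝕜 := ℝ) hw0
    · simp only [map_smul, hPu, hQw]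
      exact happ.smul _
  have hmono : ∀ n, approxPairs α k (c (n + 1)) ⊆ approxPairs α k (c n) := by
    rintro n p ⟨h1, h2⟩
    refine ⟨h1, h2.mono ?_⟩
    simp only [hc]
    have : (1 : ℝ) / (((n + 1 : ℕ) : ℝ) + 1) ≤ 1 / ((n : ℝ) + 1) := by
      apply one_div_le_one_div_of_le (by positivity)
      push_cast
      linarith
    linarith
  obtain ⟨⟨u, w⟩, hp⟩ := IsCompact.nonempty_iInter_of_sequence_nonempty_isCompact_isClosed
    (fun n => approxPairs α k (c n)) hmono hne (isCompact_approxPairs hα k (hcpos 0))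
    (fun n => isClosed_approxPairs α k (c n))
  simp only [Set.mem_iInter] at hp
  have hw0 : interp k w ≠ 0 := by
    intro h
    have : w = 0 := by
      ext i
      rw [← interp_eval_node w i, h, eval_zero, Pi.zero_apply]
    have h1 := (hp 0).1
    simp [this] at h1
  refine ⟨quot (interp k u) (interp k w),
    quot_mem_ratClass (natDegree_interp_le u) (natDegree_interp_le w) hw0, fun s hs => ?_⟩
  have hle : I ≤ supError (1 - α) s := iInf₂_le s hs
  refine le_trans ?_ hle
  rw [← ENNReal.ofReal_toReal hItop, supError_le_iff hα hw0 ENNReal.toReal_nonneg]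
  intro t ht
  have hlim : Tendsto (fun n => c n * |(interp k w).eval t|) atTop
      (𝓝 ((I.toReal + 0) * |(interp k w).eval t|)) :=
    (tendsto_const_nhds.add tendsto_one_div_add_atTop_nhds_zero_nat).mul_const _
  rw [add_zero] at hlim
  exact ge_of_tendsto' hlim fun n => (hp n).2 t ht

/-- The reduced form of a best approximation. -/
theorem IsBURA.reduced {α : ℝ} (hα : 0 < α) {k : ℕ} {r : RatFunc ℝ} (hr : IsBURA (1 - α) k k r) :
    r.num.natDegree ≤ k ∧ r.denom.natDegree ≤ k ∧
    ApproxWithin α (bestError (1 - α) k k) r.num r.denom ∧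
    ∀ P Q : ℝ[X], P.natDegree ≤ k → Q.natDegree ≤ k → Q ≠ 0 → ∀ c, 0 ≤ c →
      ApproxWithin α c P Q → bestError (1 - α) k k ≤ c := by
  obtain ⟨hmem, hmin⟩ := hr
  have hinf : (⨅ s ∈ ratClass k k, supError (1 - α) s) = supError (1 - α) r :=
    le_antisymm (iInf₂_le _ hmem) (le_iInf₂ hmin)
  have hE : bestError (1 - α) k k = (supError (1 - α) r).toReal := by rw [bestError, hinf]
  have h01 : quot 0 1 ∈ ratClass k k :=
    quot_mem_ratClass (by simp) (by simp) one_ne_zero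
  have htop : supError (1 - α) r ≠ ⊤ :=
    ne_top_of_le_ne_top ENNReal.ofReal_ne_top ((hmin _ h01).trans (supError_zero_le hα))
  have hrq : quot r.num r.denom = r := RatFunc.num_div_denom r
  refine ⟨?_, ?_, ?_, ?_⟩
  · obtain ⟨P, Q, hP, hQ, hQm, rfl⟩ := hmem
    by_cases hP0 : P = 0
    · simp [hP0]
    · exact (natDegree_le_of_dvd (RatFunc.num_div_dvd P hQm.ne_zero) hP0).trans hP
  · obtain ⟨P, Q, hP, hQ, hQm, rfl⟩ := hmem
    exact (natDegree_le_of_dvd (RatFunc.denom_div_dvd P Q) hQm.ne_zero).trans hQ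
  · rw [← supError_le_iff hα r.denom_ne_zero (by rw [hE]; exact ENNReal.toReal_nonneg), hrq, hE,
      ENNReal.ofReal_toReal htop]
  · intro P Q hP hQ hQ0 c hc h
    rw [hE]
    refine ENNReal.toReal_le_of_le_ofReal hc ?_
    exact (hmin _ (quot_mem_ratClass hP hQ hQ0)).trans ((supError_le_iff hα hQ0 hc).2 h)

/-! ### Improving an approximation with too few interpolation points. -/

lemma nonneg_on_Icc_of_pos {h : ℝ → ℝ} (hc : Continuous h) {a b c : ℝ} (hcab : c ∈ Set.Ioo a b)
    (hpos : 0 < h c) (hne : ∀ t ∈ Set.Ioo a b, h t ≠ 0) : ∀ t ∈ Set.Icc a b, 0 ≤ h t := by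
  have hsub : Set.Ioo a b ⊆ {t | 0 ≤ h t} := by
    intro t ht
    by_contra hlt
    have hlt' : h t < 0 := not_le.1 hlt
    obtain ⟨s, hs, hs0⟩ := isPreconnected_Ioo.intermediate_value ht hcab hc.continuousOn
      ⟨hlt'.le, hpos.le⟩
    exact hne s hs hs0
  intro t ht
  rw [← closure_Ioo (hcab.1.trans hcab.2).ne] at ht
  exact closure_minimal hsub (isClosed_le continuous_const hc) ht

lemma constant_sign_on_Icc {h : ℝ → ℝ} (hc : Continuous h) {a b : ℝ} (hab : a < b)
    (hne : ∀ t ∈ Set.Ioo a b, h t ≠ 0) :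
    (∀ t ∈ Set.Icc a b, 0 ≤ h t) ∨ (∀ t ∈ Set.Icc a b, h t ≤ 0) := by
  have hmid : (a + b) / 2 ∈ Set.Ioo a b := ⟨by linarith, by linarith⟩
  rcases (hne _ hmid).lt_or_gt with hlt | hgt
  · right
    have := nonneg_on_Icc_of_pos hc.neg hmid (neg_pos.2 hlt) fun t ht => neg_ne_zero.2 (hne t ht)
    exact fun t ht => neg_nonneg.1 (this t ht)
  · exact Or.inl (nonneg_on_Icc_of_pos hc hmid hgt hne)

/-- A continuous function with finitely many zeros has the sign pattern of a polynomial. -/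
theorem exists_polynomial_mul_nonneg {g : ℝ → ℝ} (hg : Continuous g) (Z : Finset ℝ) :
    ∀ b, 0 < b → (∀ t ∈ Set.Ioo 0 b, g t = 0 → t ∈ Z) →
      ∃ w : ℝ[X], w.natDegree ≤ Z.card ∧ (∀ t ∈ Set.Icc 0 b, 0 ≤ w.eval t * g t) ∧
        ∀ t, w.eval t = 0 → t ∈ Z := by
  induction Z using Finset.induction_on_max with
  | empty =>
    intro b hb hZ
    rcases constant_sign_on_Icc hg hb (fun t ht h0 => by simpa using hZ t ht h0) with h | h
    · exact ⟨1, by simp, fun t ht => by simpa using h t ht, fun t ht => by simp at ht⟩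
    · exact ⟨-1, by simp, fun t ht => by simpa using h t ht, fun t ht => by simp at ht⟩
  | insert a Z hlt ih =>
    intro b hb hZ
    have ha : a ∉ Z := fun h => lt_irrefl a (hlt a h)
    rw [Finset.card_insert_of_notMem ha]
    by_cases hab : a ∈ Set.Ioo 0 b
    · obtain ⟨w, hwd, hw, hwr⟩ := ih a hab.1 fun t ht h0 =>
        (Finset.mem_insert.1 (hZ t ⟨ht.1, ht.2.trans hab.2⟩ h0)).resolve_left ht.2.ne
      have hne : ∀ t ∈ Set.Ioo a b, w.eval t * g t ≠ 0 := by
        intro t ht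
        refine mul_ne_zero (fun h => lt_asymm ht.1 (hlt t (hwr t h))) fun h => ?_
        rcases Finset.mem_insert.1 (hZ t ⟨hab.1.trans ht.1, ht.2⟩ h) with h | h
        exacts [ht.1.ne' h, lt_asymm ht.1 (hlt t h)]
      -- The factor `a - X` is inserted only when `w g` changes sign at `a`; zeros without a sign
      -- change cost no degree.
      rcases constant_sign_on_Icc (w.continuous.mul hg) hab.2 hne with h | h
      · refine ⟨w, by omega, fun t ht => ?_, fun t ht => Finset.mem_insert_of_mem (hwr t ht)⟩
        rcases le_total t a with hta | hta
        exacts [hw t ⟨ht.1, hta⟩, h t ⟨hta, ht.2⟩]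
      · refine ⟨w * (C a - X), ?_, fun t ht => ?_, fun t ht => ?_⟩
        · have h1 : (C a - X : ℝ[X]).natDegree ≤ 1 := by compute_degree
          exact natDegree_mul_le.trans (add_le_add hwd h1)
        · have he : (w * (C a - X)).eval t * g t = (a - t) * (w.eval t * g t) := by
            simp only [eval_mul, eval_sub, eval_C, eval_X]
            ring
          rw [he]
          rcases le_total t a with hta | hta
          · exact mul_nonneg (sub_nonneg.2 hta) (hw t ⟨ht.1, hta⟩)
          · exact mul_nonneg_of_nonpos_of_nonpos (sub_nonpos.2 hta) (h t ⟨hta, ht.2⟩)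
        · simp only [eval_mul, eval_sub, eval_C, eval_X, mul_eq_zero] at ht
          rcases ht with ht | ht
          · exact Finset.mem_insert_of_mem (hwr t ht)
          · exact Finset.mem_insert.2 (Or.inl (by linarith))
    · obtain ⟨w, hwd, hw, hwr⟩ := ih b hb fun t ht h0 =>
        (Finset.mem_insert.1 (hZ t ht h0)).resolve_left fun h => hab (h ▸ ht)
      exact ⟨w, by omega, hw, fun t ht => Finset.mem_insert_of_mem (hwr t ht)⟩

/-- A Bézout identity with control of the degrees. -/
lemma exists_bezout_natDegree_le {A B w : ℝ[X]} {k m : ℕ} (hAB : IsCoprime A B) (hA0 : A ≠ 0)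
    (hA : A.natDegree = m) (hB : B.natDegree ≤ m) (hm : m ≤ k) (hw : w.natDegree ≤ k + m) :
    ∃ x y : ℝ[X], x.natDegree ≤ k ∧ y.natDegree ≤ k ∧ w = A * x + B * y := by
  obtain ⟨u, v, huv⟩ := hAB
  have hdm := EuclideanDomain.div_add_mod (w * v) A
  -- Reducing modulo `A` bounds the degree of `y`. That of `x` is then forced by `A x = w - B y`.
  set y := (w * v) % A with hy
  set x := w * u + B * ((w * v) / A) with hx
  have hid : w = A * x + B * y := by
    rw [hx]
    linear_combination (-w) * huv - B * hdm
  have hyd : y.natDegree ≤ m := by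
    rw [← hA]
    exact natDegree_le_natDegree (EuclideanDomain.mod_lt (w * v) hA0).le
  refine ⟨x, y, ?_, hyd.trans hm, hid⟩
  by_cases hx0 : x = 0
  · simp [hx0]
  have h1 : (A * x).natDegree = m + x.natDegree := by rw [natDegree_mul hA0 hx0, hA]
  have h2 : A * x = w - B * y := by linear_combination -hid
  have h3 : (w - B * y).natDegree ≤ k + m := by
    refine (natDegree_sub_le _ _).trans (max_le hw ?_)
    exact natDegree_mul_le.trans (by omega)
  rw [← h2, h1] at h3
  omega

/-- Improving an approximation whose extremal points are separated by `Q a - P b`. -/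
theorem exists_better_approx {α : ℝ} (hα : 0 < α) {k : ℕ} {P Q a b : ℝ[X]} {E : ℝ}
    (hP : P.natDegree ≤ k) (hQ : Q.natDegree ≤ k) (ha : a.natDegree ≤ k) (hb : b.natDegree ≤ k)
    (hE : 0 < E) (hQ0 : ∀ t ∈ Set.Icc (0 : ℝ) 1, Q.eval t ≠ 0) (happ : ApproxWithin α E P Q)
    (hw : ∀ t ∈ Set.Icc (0 : ℝ) 1, |P.eval t - t ^ α * Q.eval t| = E * |Q.eval t| →
      0 < (Q * a - P * b).eval t * ((P.eval t - t ^ α * Q.eval t) * Q.eval t)) :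
    ∃ P' Q' : ℝ[X], P'.natDegree ≤ k ∧ Q'.natDegree ≤ k ∧ Q' ≠ 0 ∧
      ∃ c, 0 ≤ c ∧ c < E ∧ ApproxWithin α c P' Q' := by
  set G : ℝ → ℝ := fun t => P.eval t - t ^ α * Q.eval t with hG
  set D : ℝ → ℝ := fun t => a.eval t - t ^ α * b.eval t with hD
  have hGc : Continuous G := continuous_residual hα P Q
  have hDc : Continuous D := continuous_residual hα a b
  -- For the perturbed pair, `E²(Q - ε b)² - (G - ε D)² = A₀ + 2 ε A₁ + ε² A₂`. The goal is one `ε >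
  -- 0` making this positive on all of `[0,1]`.
  set A₀ : ℝ → ℝ := fun t => E ^ 2 * Q.eval t ^ 2 - G t ^ 2 with hA₀
  set A₁ : ℝ → ℝ := fun t => G t * D t - E ^ 2 * Q.eval t * b.eval t with hA₁
  set A₂ : ℝ → ℝ := fun t => E ^ 2 * b.eval t ^ 2 - D t ^ 2 with hA₂
  have hc₀ : Continuous A₀ := by fun_prop
  have hc₁ : Continuous A₁ := by fun_prop
  have hc₂ : Continuous A₂ := by fun_prop
  have hA₀nn : ∀ t ∈ Set.Icc (0 : ℝ) 1, 0 ≤ A₀ t := by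
    intro t ht
    have := pow_le_pow_left₀ (abs_nonneg _) (happ t ht) 2
    rw [mul_pow, sq_abs, sq_abs] at this
    simp only [hA₀, hG]
    linarith
  have hloc : ∀ t₀ ∈ Set.Icc (0 : ℝ) 1, ∀ᶠ p : ℝ × ℝ in 𝓝 t₀ ×ˢ 𝓝 0,
      p.1 ∈ Set.Icc (0 : ℝ) 1 → 0 < p.2 → 0 < A₀ p.1 + p.2 * (2 * A₁ p.1 + p.2 * A₂ p.1) := by
    intro t₀ ht₀
    rw [← nhds_prod_eq]
    rcases (hA₀nn t₀ ht₀).eq_or_lt with h0 | hpos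
    · have habs : |G t₀| = E * |Q.eval t₀| := by
        rw [← abs_of_pos hE, ← abs_mul, ← sq_eq_sq_iff_abs_eq_abs]
        simp only [hA₀] at h0
        linarith
      have hA₁pos : 0 < A₁ t₀ := by
        have hpos := hw t₀ ht₀ habs
        have hq := hQ0 t₀ ht₀
        have hq2 : 0 < Q.eval t₀ ^ 2 := by positivity
        -- At an extremal point `E² Q² = G²`, and `Q D - G b = Q a - P b` because the `t ^ α` terms
        -- cancel.
        have heq : Q.eval t₀ ^ 2 * A₁ t₀ = (Q * a - P * b).eval t₀ * (G t₀ * Q.eval t₀) := by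
          simp only [hA₀] at h0
          have h1 : E ^ 2 * Q.eval t₀ ^ 2 = G t₀ ^ 2 := by linarith
          simp only [hA₁, eval_sub, eval_mul]
          have h2 : P.eval t₀ = G t₀ + t₀ ^ α * Q.eval t₀ := by simp only [hG]; ring
          rw [h2]
          simp only [hD]
          linear_combination (-(Q.eval t₀ * b.eval t₀)) * h1
        rw [← heq] at hpos
        exact (mul_pos_iff_of_pos_left hq2).1 hpos
      have hcont : ContinuousAt (fun p : ℝ × ℝ => 2 * A₁ p.1 + p.2 * A₂ p.1) (t₀, 0) := by
        apply Continuous.continuousAt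
        fun_prop
      have hev : ∀ᶠ p : ℝ × ℝ in 𝓝 (t₀, 0), 0 < 2 * A₁ p.1 + p.2 * A₂ p.1 :=
        hcont.eventually (lt_mem_nhds (by simpa using hA₁pos))
      filter_upwards [hev] with p hp hp1 hp2
      exact add_pos_of_nonneg_of_pos (hA₀nn _ hp1) (mul_pos hp2 hp)
    · have hcont : ContinuousAt
          (fun p : ℝ × ℝ => A₀ p.1 + p.2 * (2 * A₁ p.1 + p.2 * A₂ p.1)) (t₀, 0) := by
        apply Continuous.continuousAt
        fun_prop
      have hev := hcont.eventually (lt_mem_nhds (by simpa using hpos))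
      filter_upwards [hev] with p hp _ _
      exact hp
  -- Compactness of `[0,1]` turns the local ranges of `ε` into a common one.
  have hunif := isCompact_Icc.mem_nhdsSet_prod_of_forall hloc
  obtain ⟨U, hU, V, hV, hUV⟩ := mem_prod_iff.1 hunif
  obtain ⟨ε, hεV, hε⟩ : ∃ ε ∈ V, (0 : ℝ) < ε := by
    obtain ⟨δ, hδ, hball⟩ := Metric.mem_nhds_iff.1 hV
    exact ⟨δ / 2, hball (by simp [abs_of_pos hδ]; linarith), by positivity⟩
  have hkey : ∀ t ∈ Set.Icc (0 : ℝ) 1, |(P - C ε * a).eval t - t ^ α * (Q - C ε * b).eval t| <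
      E * |(Q - C ε * b).eval t| := by
    intro t ht
    have hpos := hUV (Set.mk_mem_prod (subset_of_mem_nhdsSet hU ht) hεV) ht hε
    rw [← abs_of_pos hE, ← abs_mul, ← sq_lt_sq]
    simp only [hA₀, hA₁, hA₂, hG, hD] at hpos
    simp only [eval_sub, eval_mul, eval_C]
    linarith
  have hQ'0 : ∀ t ∈ Set.Icc (0 : ℝ) 1, (Q - C ε * b).eval t ≠ 0 := by
    intro t ht h0
    have := hkey t ht
    rw [h0] at this
    simp only [abs_zero, mul_zero] at this
    exact absurd this (not_lt.2 (abs_nonneg _))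
  have h0mem : (0 : ℝ) ∈ Set.Icc (0 : ℝ) 1 := ⟨le_rfl, zero_le_one⟩
  refine ⟨P - C ε * a, Q - C ε * b, ?_, ?_, fun h => hQ'0 0 h0mem (by simp [h]), ?_⟩
  · exact (natDegree_sub_le _ _).trans (max_le hP ((natDegree_C_mul_le _ _).trans ha))
  · exact (natDegree_sub_le _ _).trans (max_le hQ ((natDegree_C_mul_le _ _).trans hb))
  -- The pointwise strict bound becomes a uniform constant below `E` because the maximum is
  -- attained.
  have hcont : ContinuousOn (fun t => |(P - C ε * a).eval t - t ^ α * (Q - C ε * b).eval t| /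
      |(Q - C ε * b).eval t|) (Set.Icc (0 : ℝ) 1) :=
    (continuous_residual hα _ _).abs.continuousOn.div (Polynomial.continuous _).abs.continuousOn
      fun t ht => abs_ne_zero.2 (hQ'0 t ht)
  obtain ⟨t₁, ht₁, hmax⟩ := isCompact_Icc.exists_isMaxOn ⟨0, h0mem⟩ hcont
  refine ⟨|(P - C ε * a).eval t₁ - t₁ ^ α * (Q - C ε * b).eval t₁| / |(Q - C ε * b).eval t₁|,
    by positivity, ?_, fun t ht => ?_⟩
  · rw [div_lt_iff₀ (abs_pos.2 (hQ'0 t₁ ht₁))]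
    exact hkey t₁ ht₁
  · rw [← div_le_iff₀ (abs_pos.2 (hQ'0 t ht))]
    exact hmax ht

/-- The number of positive zeros of `Q(t) t ^ α - P(t)`. -/
lemma card_zeros_le {α : ℝ} (hα : α ∈ Set.Ioo (0 : ℝ) 1) {m : ℕ} {P Q : ℝ[X]}
    (hP : P.natDegree ≤ m) (hQ : Q.natDegree ≤ m) (hQ0 : Q ≠ 0) {Z : Finset ℝ}
    (hZ : ∀ t ∈ Z, 0 < t ∧ Q.eval t * t ^ α = P.eval t) : Z.card ≤ 2 * m + 1 := by
  by_contra hlt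
  push Not at hlt
  obtain ⟨S, hSZ, hS⟩ := Finset.exists_subset_card_eq hlt.le
  obtain ⟨t, htZ, htS⟩ := Finset.exists_mem_notMem_of_card_lt_card (hS ▸ hlt)
  have := mul_residual_pos hα (fun x hx => (hZ x (hSZ hx)).1) hS hP hQ hQ0
    (fun x hx => (hZ x (hSZ hx)).2) (hZ t htZ).1 htS
  rw [(hZ t htZ).2] at this
  simp at this

/-- The interpolation points of a best approximation. -/
theorem IsBURA.exists_zeros {α : ℝ} (hα : α ∈ Set.Ioo (0 : ℝ) 1) {k : ℕ} {r : RatFunc ℝ}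
    (hr : IsBURA (1 - α) k k r) :
    ∃ S : Finset ℝ, S.card = 2 * k + 1 ∧ (∀ t, t ∈ S ↔ t ∈ Set.Ioo (0 : ℝ) 1 ∧
      r.denom.eval t * t ^ α = r.num.eval t) := by
  obtain ⟨hPk, hQk, happ, hmin⟩ := hr.reduced hα.1
  set P := r.num
  set Q := r.denom
  set E := bestError (1 - α) k k with hEdef
  have hcop : IsCoprime P Q := r.isCoprime_num_denom
  have hQ0 : Q ≠ 0 := r.denom_ne_zero
  -- In cleared form, a root of `Q` would also be a root of `P`, against coprimality.
  have hQt : ∀ t ∈ Set.Icc (0 : ℝ) 1, Q.eval t ≠ 0 := by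
    intro t ht h0
    have h1 := happ t ht
    rw [h0] at h1
    simp only [mul_zero, sub_zero, abs_zero] at h1
    have h2 : P.eval t = 0 := abs_nonpos_iff.1 h1
    obtain ⟨u, v, huv⟩ := hcop
    have := congrArg (eval t) huv
    simp [h0, h2] at this
  set m := max P.natDegree Q.natDegree with hm
  have hmk : m ≤ k := max_le hPk hQk
  have hPm : P.natDegree ≤ m := le_max_left _ _
  have hQm : Q.natDegree ≤ m := le_max_right _ _
  set Zs : Set ℝ := {t | t ∈ Set.Ioo (0 : ℝ) 1 ∧ Q.eval t * t ^ α = P.eval t} with hZs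
  have hfin : Zs.Finite := by
    by_contra hinf
    obtain ⟨T, hT, hTc⟩ := Set.Infinite.exists_subset_card_eq hinf (2 * m + 2)
    have := card_zeros_le hα hPm hQm hQ0 (Z := T) fun t ht => ⟨(hT ht).1.1, (hT ht).2⟩
    omega
  set Z := hfin.toFinset with hZ
  have hmem : ∀ t, t ∈ Z ↔ t ∈ Set.Ioo (0 : ℝ) 1 ∧ Q.eval t * t ^ α = P.eval t := fun t => by
    rw [hZ, Set.Finite.mem_toFinset]
    rfl
  have hle : Z.card ≤ 2 * m + 1 :=
    card_zeros_le hα hPm hQm hQ0 fun t ht => ⟨((hmem t).1 ht).1.1, ((hmem t).1 ht).2⟩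
  -- Zero error would make every point `1/(n + 2)` a zero, against finiteness.
  have hE : 0 < E := by
    refine lt_of_le_of_ne (by rw [hEdef]; exact ENNReal.toReal_nonneg) fun h0 => ?_
    refine Set.infinite_of_injective_forall_mem (f := fun n : ℕ => (1 : ℝ) / ((n : ℝ) + 2)) ?_
      (fun n => ?_) hfin
    · intro i j hij
      simp only [one_div, inv_inj, add_left_inj, Nat.cast_inj] at hij
      exact hij
    · have hmem : (1 : ℝ) / ((n : ℝ) + 2) ∈ Set.Ioo (0 : ℝ) 1 := by
        refine ⟨by positivity, ?_⟩
        rw [div_lt_one (by positivity)]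
        have : (0 : ℝ) ≤ n := n.cast_nonneg
        linarith
      refine ⟨hmem, ?_⟩
      have h1 := happ _ ⟨hmem.1.le, hmem.2.le⟩
      rw [← h0, zero_mul] at h1
      have h2 := abs_nonpos_iff.1 h1
      linarith
  have hge : k + m + 1 ≤ Z.card := by
    by_contra hlt
    obtain ⟨w, hwd, hw, hwr⟩ := exists_polynomial_mul_nonneg (continuous_residual hα.1 P Q) Z 1
      one_pos fun t ht h0 => (hmem t).2 ⟨ht, by linarith⟩
    have hwpos : ∀ t ∈ Set.Icc (0 : ℝ) 1,
        |P.eval t - t ^ α * Q.eval t| = E * |Q.eval t| →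
          0 < w.eval t * (P.eval t - t ^ α * Q.eval t) := by
      intro t ht habs
      have hG : P.eval t - t ^ α * Q.eval t ≠ 0 := by
        rw [← abs_pos, habs]
        exact mul_pos hE (abs_pos.2 (hQt t ht))
      refine lt_of_le_of_ne (hw t ht) (mul_ne_zero (fun h => hG ?_) hG).symm
      have := ((hmem t).1 (hwr t h)).2
      linarith
    -- The improvement criterion involves the sign of `(P - t ^ α Q) Q`, so `w` is corrected by the
    -- constant sign of `Q`.
    obtain ⟨s, hsQ⟩ : ∃ s : ℝ, ∀ t ∈ Set.Icc (0 : ℝ) 1, 0 < s * Q.eval t := by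
      rcases constant_sign_on_Icc Q.continuous zero_lt_one
        (fun t ht => hQt t ⟨ht.1.le, ht.2.le⟩) with h | h
      · exact ⟨1, fun t ht => by
          rw [one_mul]; exact lt_of_le_of_ne (h t ht) (hQt t ht).symm⟩
      · exact ⟨-1, fun t ht => by
          rw [neg_one_mul]; exact neg_pos.2 (lt_of_le_of_ne (h t ht) (hQt t ht))⟩
    have hswd : (C s * w).natDegree ≤ k + m := (natDegree_C_mul_le _ _).trans (by omega)
    obtain ⟨a, b, ha, hb, hab⟩ : ∃ a b : ℝ[X], a.natDegree ≤ k ∧ b.natDegree ≤ k ∧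
        C s * w = Q * a - P * b := by
      -- Bézout is applied modulo whichever of `P`, `Q` has degree exactly `m`.
      by_cases hQd : Q.natDegree = m
      · obtain ⟨x, y, hx, hy, hxy⟩ :=
          exists_bezout_natDegree_le hcop.symm hQ0 hQd hPm hmk hswd
        exact ⟨x, -y, hx, by rwa [natDegree_neg], by rw [hxy]; ring⟩
      · have hPd : P.natDegree = m := by omega
        have hP0 : P ≠ 0 := fun h => by
          rw [h, natDegree_zero] at hPd
          omega
        obtain ⟨x, y, hx, hy, hxy⟩ :=
          exists_bezout_natDegree_le hcop hP0 hPd hQm hmk hswd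
        exact ⟨y, -x, hy, by rwa [natDegree_neg], by rw [hxy]; ring⟩
    obtain ⟨P', Q', hP', hQ', hQ'0, c, hc0, hcE, hc⟩ :=
      exists_better_approx hα.1 hPk hQk ha hb hE hQt happ (fun t ht habs => by
        rw [← hab, eval_mul, eval_C]
        have := mul_pos (hwpos t ht habs) (hsQ t ht)
        calc 0 < _ := this
          _ = _ := by ring)
    exact absurd (hmin P' Q' hP' hQ' hQ'0 c hc0 hc) (not_le.2 hcE)
  -- From `k + m + 1 ≤ Z.card ≤ 2 m + 1` and `m ≤ k` it follows that `m = k`.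
  exact ⟨Z, by omega, hmem⟩

/-! ### Reduction of the matrix error to the spectrum. -/

variable {N : ℕ}

/-- Diagonal matrices in the eigenbasis of a Hermitian matrix. -/
noncomputable def diagConj {A : Matrix (Fin N) (Fin N) ℝ} (hA : A.IsHermitian) :
    (Fin N → ℝ) →ₐ[ℝ] Matrix (Fin N) (Fin N) ℝ :=
  (Unitary.conjStarAlgAut ℝ (Matrix (Fin N) (Fin N) ℝ)
    hA.eigenvectorUnitary).toAlgEquiv.toAlgHom.comp (Matrix.diagonalAlgHom ℝ)

lemma diagConj_apply {A : Matrix (Fin N) (Fin N) ℝ} (hA : A.IsHermitian) (g : Fin N → ℝ) :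
    diagConj hA g = Unitary.conjStarAlgAut ℝ (Matrix (Fin N) (Fin N) ℝ)
      hA.eigenvectorUnitary (Matrix.diagonal g) := rfl

lemma diagConj_eigenvalues {A : Matrix (Fin N) (Fin N) ℝ} (hA : A.IsHermitian) :
    diagConj hA hA.eigenvalues = A := by
  conv_rhs => rw [hA.spectral_theorem]
  rfl

lemma fracPow_eq {A : Matrix (Fin N) (Fin N) ℝ} (hA : A.IsHermitian) (s : ℝ) :
    fracPow hA s = diagConj hA (fun i => hA.eigenvalues i ^ s) := rfl

lemma aeval_rescaled {A : Matrix (Fin N) (Fin N) ℝ} (hA : A.IsHermitian) (p : ℝ[X]) :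
    aeval (rescaled A) p =
      diagConj hA (fun i => p.eval ((rowNorm A)⁻¹ * hA.eigenvalues i)) := by
  have h : rescaled A = diagConj hA (fun i => (rowNorm A)⁻¹ * hA.eigenvalues i) := by
    calc rescaled A = (rowNorm A)⁻¹ • diagConj hA hA.eigenvalues := by
          rw [diagConj_eigenvalues, rescaled]
      _ = _ := (map_smul (diagConj hA) _ _).symm
  rw [h, aeval_algHom_apply, aeval_pi_apply]
  simp only [coe_aeval_eq_eval]

lemma diagConj_mul_inv {A : Matrix (Fin N) (Fin N) ℝ} (hA : A.IsHermitian) {g : Fin N → ℝ}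
    (hg : ∀ i, g i ≠ 0) : diagConj hA g * diagConj hA (fun i => (g i)⁻¹) = 1 := by
  rw [← map_mul, ← map_one (diagConj hA)]
  congr 1
  ext i
  simp [hg i]

lemma isUnit_diagConj {A : Matrix (Fin N) (Fin N) ℝ} (hA : A.IsHermitian) {g : Fin N → ℝ}
    (hg : ∀ i, g i ≠ 0) : IsUnit (diagConj hA g) :=
  IsUnit.of_mul_eq_one _ (diagConj_mul_inv hA hg)

lemma diagConj_inv {A : Matrix (Fin N) (Fin N) ℝ} (hA : A.IsHermitian) {g : Fin N → ℝ}
    (hg : ∀ i, g i ≠ 0) : (diagConj hA g)⁻¹ = diagConj hA (fun i => (g i)⁻¹) :=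
  Matrix.inv_eq_right_inv (diagConj_mul_inv hA hg)

lemma ratMat_rescaled {A : Matrix (Fin N) (Fin N) ℝ} (hA : A.IsHermitian) {r : RatFunc ℝ}
    (hd : ∀ i, r.denom.eval ((rowNorm A)⁻¹ * hA.eigenvalues i) ≠ 0) :
    ratMat r (rescaled A) =
      diagConj hA (fun i => val r ((rowNorm A)⁻¹ * hA.eigenvalues i)) := by
  rw [ratMat, aeval_rescaled hA, aeval_rescaled hA, diagConj_inv hA hd, ← map_mul]
  congr 1

-- Unitary conjugation preserves the operator norm, which for a diagonal matrix is the largest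
-- absolute entry.
open scoped Matrix.Norms.L2Operator in
lemma norm_diagConj_le {A : Matrix (Fin N) (Fin N) ℝ} (hA : A.IsHermitian) {g : Fin N → ℝ}
    {M : ℝ} (hM : 0 ≤ M) (hg : ∀ i, |g i| ≤ M) (f : EuclideanSpace ℝ (Fin N)) :
    ‖Matrix.toEuclideanLin (diagConj hA g) f‖ ≤ M * ‖f‖ := by
  have h1 : ‖diagConj hA g‖ ≤ M := by
    have h2 : ‖diagConj hA g‖ = ‖Matrix.diagonal g‖ := by
      rw [diagConj_apply, Unitary.conjStarAlgAut_apply, ← Unitary.coe_star,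
        CStarRing.norm_mul_coe_unitary, CStarRing.norm_coe_unitary_mul]
    rw [h2, Matrix.l2_opNorm_diagonal]
    exact (pi_norm_le_iff_of_nonneg hM).2 hg
  exact (Matrix.l2_opNorm_mulVec (diagConj hA g) f).trans
    (mul_le_mul_of_nonneg_right h1 (norm_nonneg f))

/-- The relative error is controlled on the spectrum. -/
theorem relError_le {α : ℝ} {r : RatFunc ℝ} {A : Matrix (Fin N) (Fin N) ℝ} (hA : A.IsHermitian)
    (hd : ∀ i, r.denom.eval ((rowNorm A)⁻¹ * hA.eigenvalues i) ≠ 0)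
    (hv : ∀ i, val r ((rowNorm A)⁻¹ * hA.eigenvalues i) ≠ 0) {M : ℝ} (hM : 0 ≤ M)
    (hbound : ∀ i, |rowNorm A ^ (-α) * (val r ((rowNorm A)⁻¹ * hA.eigenvalues i))⁻¹ -
      hA.eigenvalues i ^ (-α)| ≤ M) {f : EuclideanSpace ℝ (Fin N)} (hf : f ≠ 0) :
    relError α r hA f ≤ M := by
  rw [relError, div_le_iff₀ (norm_pos_iff.2 hf)]
  have h : approxSol α r A f - exactSol α hA f = Matrix.toEuclideanLin (diagConj hA
      (fun i => rowNorm A ^ (-α) * (val r ((rowNorm A)⁻¹ * hA.eigenvalues i))⁻¹ -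
        hA.eigenvalues i ^ (-α))) f := by
    rw [approxSol, exactSol, ratMat_rescaled hA hd, diagConj_inv hA hv, fracPow_eq,
      ← LinearMap.smul_apply, ← map_smul, ← map_smul, ← LinearMap.sub_apply, ← map_sub, ← map_sub]
    rfl
  rw [h]
  exact norm_diagConj_le hA hM hbound f

/-- By Gershgorin's theorem; this places the rescaled spectrum in `[0,1]` for positive definite `A`,
where the approximation error is controlled. -/
lemma eigenvalues_le_rowNorm {A : Matrix (Fin N) (Fin N) ℝ} (hA : A.IsHermitian) (i : Fin N) :
    hA.eigenvalues i ≤ rowNorm A := by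
  have hev : Module.End.HasEigenvalue (Matrix.toLin' A) (hA.eigenvalues i) := by
    rw [Module.End.hasEigenvalue_iff_mem_spectrum, Matrix.spectrum_toLin']
    exact hA.eigenvalues_mem_spectrum_real i
  obtain ⟨j, hj⟩ := eigenvalue_mem_ball hev
  rw [Metric.mem_closedBall, Real.dist_eq] at hj
  have h1 : hA.eigenvalues i ≤ ∑ l, |A j l| := by
    rw [← Finset.add_sum_erase _ _ (Finset.mem_univ j)]
    simp only [Real.norm_eq_abs] at hj
    have h2 := le_abs_self (hA.eigenvalues i - A j j)
    have h3 := le_abs_self (A j j)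
    linarith
  exact h1.trans (le_ciSup (f := fun j => ∑ l, |A j l|) (Set.finite_range _).bddAbove j)

lemma exists_lamMin_eq {A : Matrix (Fin N) (Fin N) ℝ} (hN : 0 < N) (hA : A.IsHermitian) :
    ∃ i, lamMin A = hA.eigenvalues i := by
  have : Nonempty (Fin N) := ⟨⟨0, hN⟩⟩
  have h : lamMin A ∈ Set.range hA.eigenvalues := by
    rw [lamMin, hA.spectrum_real_eq_range_eigenvalues]
    exact (Set.range_nonempty _).csInf_mem (Set.finite_range _)
  obtain ⟨i, hi⟩ := h
  exact ⟨i, hi.symm⟩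

lemma lamMin_le {A : Matrix (Fin N) (Fin N) ℝ} (hA : A.IsHermitian) (i : Fin N) :
    lamMin A ≤ hA.eigenvalues i := by
  rw [lamMin, hA.spectrum_real_eq_range_eigenvalues]
  exact csInf_le (Set.finite_range _).bddBelow ⟨i, rfl⟩

/-! ### Scalar estimates and the sign between consecutive nodes. -/

/-- The difference of reciprocals is `|ρ - μ ^ α| / (ρ μ ^ α)`, and both factors below are at least
`μ₁ ^ α`. Here `C μ` plays the role of an eigenvalue of the unscaled matrix. -/
lemma abs_inv_sub_rpow_le {α C ρ μ μ₁ E : ℝ} (hC : 0 < C) (hα : 0 < α) (hμ₁ : 0 < μ₁)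
    (hμ : μ₁ ≤ μ) (hρ : μ₁ ^ α ≤ ρ) (hE : |ρ - μ ^ α| ≤ E) :
    |C ^ (-α) * ρ⁻¹ - (C * μ) ^ (-α)| ≤ C ^ α * E / (C * μ₁) ^ (2 * α) := by
  have hμ0 : 0 < μ := hμ₁.trans_le hμ
  have hx : 0 < μ₁ ^ α := Real.rpow_pos_of_pos hμ₁ _
  have hρ0 : 0 < ρ := hx.trans_le hρ
  have hy : μ₁ ^ α ≤ μ ^ α := Real.rpow_le_rpow hμ₁.le hμ hα.le
  have hy0 : 0 < μ ^ α := hx.trans_le hy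
  have hc : 0 < C ^ α := Real.rpow_pos_of_pos hC _
  rw [Real.mul_rpow hC.le hμ0.le, Real.mul_rpow hC.le hμ₁.le, Real.rpow_neg hC.le,
    Real.rpow_neg hμ0.le, mul_comm 2 α, Real.rpow_mul hC.le, Real.rpow_mul hμ₁.le]
  norm_cast
  have h1 : (C ^ α)⁻¹ * ρ⁻¹ - (C ^ α)⁻¹ * (μ ^ α)⁻¹ =
      -((ρ - μ ^ α) / (C ^ α * (ρ * μ ^ α))) := by
    field_simp
    ring
  have h2 : C ^ α * E / ((C ^ α) ^ 2 * (μ₁ ^ α) ^ 2) = E / (C ^ α * (μ₁ ^ α * μ₁ ^ α)) := by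
    field_simp
  rw [h1, h2, abs_neg, abs_div, abs_of_pos (by positivity : 0 < C ^ α * (ρ * μ ^ α))]
  exact div_le_div₀ ((abs_nonneg _).trans hE) hE (by positivity)
    (mul_le_mul_of_nonneg_left (mul_le_mul hρ hy hx.le hρ0.le) hc.le)

/-- Both reciprocals lie in `(0, μ₁ ^ (-α)]`, so no bound on the approximation error is needed. -/
lemma abs_inv_sub_rpow_le' {α C ρ μ μ₁ : ℝ} (hC : 0 < C) (hα : 0 < α) (hμ₁ : 0 < μ₁)
    (hμ : μ₁ ≤ μ) (hρ : μ₁ ^ α ≤ ρ) :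
    |C ^ (-α) * ρ⁻¹ - (C * μ) ^ (-α)| ≤ (C * μ₁) ^ (-α) := by
  have hμ0 : 0 < μ := hμ₁.trans_le hμ
  have hx : 0 < μ₁ ^ α := Real.rpow_pos_of_pos hμ₁ _
  have hρ0 : 0 < ρ := hx.trans_le hρ
  have hy : μ₁ ^ α ≤ μ ^ α := Real.rpow_le_rpow hμ₁.le hμ hα.le
  have hy0 : 0 < μ ^ α := hx.trans_le hy
  have hc : 0 < C ^ (-α) := Real.rpow_pos_of_pos hC _
  rw [Real.mul_rpow hC.le hμ0.le, Real.mul_rpow hC.le hμ₁.le, ← mul_sub, abs_mul, abs_of_pos hc,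
    Real.rpow_neg hμ0.le, Real.rpow_neg hμ₁.le]
  refine mul_le_mul_of_nonneg_left ?_ hc.le
  have h1 : ρ⁻¹ ≤ (μ₁ ^ α)⁻¹ := inv_anti₀ hx hρ
  have h2 : (μ ^ α)⁻¹ ≤ (μ₁ ^ α)⁻¹ := inv_anti₀ hx hy
  have h3 : 0 < ρ⁻¹ := inv_pos.2 hρ0
  have h4 : 0 < (μ ^ α)⁻¹ := inv_pos.2 hy0
  rw [abs_le]
  constructor <;> linarith

lemma prod_range_ite_neg_one (n M : ℕ) :
    ∏ j ∈ Finset.range M, (if n ≤ j then (-1 : ℝ) else 1) = (-1) ^ (M - n) := by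
  induction M with
  | zero => simp
  | succ M ih =>
    rw [Finset.prod_range_succ, ih]
    split_ifs with h
    · rw [Nat.succ_sub h, pow_succ]
    · rw [Nat.sub_eq_zero_of_le (by omega), Nat.sub_eq_zero_of_le (by omega), mul_one]

/-- With zero-based indices exactly `2i` nodes lie below `t`, leaving the odd number `2k + 1 - 2i`
of negative factors. -/
lemma prod_sub_orderEmb_neg {S : Finset ℝ} {k : ℕ} (hcard : S.card = 2 * k + 1) {i : ℕ}
    (hi : i ≤ k) {t : ℝ}
    (hlt : ∀ j : Fin (2 * k + 1), (j : ℕ) < 2 * i → S.orderEmbOfFin hcard j < t)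
    (hgt : ∀ j : Fin (2 * k + 1), 2 * i ≤ (j : ℕ) → t < S.orderEmbOfFin hcard j) :
    ∏ x ∈ S, (t - x) < 0 := by
  have h1 : ∏ x ∈ S, (t - x) = ∏ j, (t - S.orderEmbOfFin hcard j) := by
    conv_lhs => rw [← Finset.image_orderEmbOfFin_univ S hcard]
    exact Finset.prod_image fun a _ b _ h => (S.orderEmbOfFin hcard).injective h
  have h2 : ∀ j : Fin (2 * k + 1), t - S.orderEmbOfFin hcard j =
      |t - S.orderEmbOfFin hcard j| * (if 2 * i ≤ (j : ℕ) then -1 else 1) := by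
    intro j
    split_ifs with h
    · rw [abs_of_neg (sub_neg.2 (hgt j h))]
      ring
    · rw [abs_of_pos (sub_pos.2 (hlt j (not_le.1 h))), mul_one]
  have h3 : 0 < ∏ j, |t - S.orderEmbOfFin hcard j| := by
    refine Finset.prod_pos fun j _ => abs_pos.2 (sub_ne_zero.2 ?_)
    by_cases h : 2 * i ≤ (j : ℕ)
    · exact (hgt j h).ne
    · exact (hlt j (not_le.1 h)).ne'
  rw [h1, Finset.prod_congr rfl fun j _ => h2 j, Finset.prod_mul_distrib,
    Fin.prod_univ_eq_prod_range (fun j => if 2 * i ≤ j then (-1 : ℝ) else 1),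
    prod_range_ite_neg_one, Odd.neg_one_pow ⟨k - i, by omega⟩]
  linarith

end RBURA

/-! ### Assembly of the theorem. -/

open RBURA in
theorem mainTheorem2 (α : ℝ) (hα0 : 0 < α) (hα1 : α < 1) (k : ℕ) (hk : 1 ≤ k) :
    -- a best approximation `r_{1-α}` of `t ^ α` in `R(k,k)` exists
    (∃ r : RatFunc ℝ, RBURA.IsBURA (1 - α) k k r) ∧
    ∀ r : RatFunc ℝ, RBURA.IsBURA (1 - α) k k r →
      -- `ξ 1 < ⋯ < ξ (2k+1)` are the zeros of `r(t) - t ^ α` in `(0,1)`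
      ∃ ξ : ℕ → ℝ, StrictMonoOn ξ (Set.Icc 1 (2 * k + 1)) ∧
        ξ '' Set.Icc 1 (2 * k + 1) = {t ∈ Set.Ioo (0 : ℝ) 1 | RBURA.val r t - t ^ α = 0} ∧
        -- error bounds for a single matrix
        (∀ (N : ℕ) (_ : 0 < N) (A : Matrix (Fin N) (Fin N) ℝ) (hA : A.PosDef),
          IsUnit (Polynomial.aeval (RBURA.rescaled A) r.denom) ∧
          IsUnit (RBURA.ratMat r (RBURA.rescaled A)) ∧
          ((∃ i ∈ Set.Icc 1 k, RBURA.muMin A ∈ Set.Icc (ξ (2 * i)) (ξ (2 * i + 1))) →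
            ∀ f : EuclideanSpace ℝ (Fin N), f ≠ 0 →
              RBURA.relError α r hA.isHermitian f ≤
                (RBURA.rowNorm A) ^ α * RBURA.bestError (1 - α) k k /
                  (RBURA.lamMin A) ^ (2 * α)) ∧
          (RBURA.muMin A ∈ Set.Icc 0 (ξ 1) →
            ∀ f : EuclideanSpace ℝ (Fin N), f ≠ 0 →
              RBURA.relError α r hA.isHermitian f ≤ (RBURA.lamMin A) ^ (-α))) ∧
        -- uniform boundedness for fixed `k` along a family of matrices `A h`, as `h` runs
        -- along the filter `l`, when `λ₁` stays above `c` and `μ₁ → 0`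
        (∀ (ι : Type*) (l : Filter ι) (N : ι → ℕ) (_ : ∀ h, 0 < N h)
          (A : ∀ h, Matrix (Fin (N h)) (Fin (N h)) ℝ) (hA : ∀ h, (A h).PosDef)
          (c : ℝ) (_ : 0 < c) (_ : ∀ᶠ h in l, c ≤ RBURA.lamMin (A h))
          (_ : Tendsto (fun h => RBURA.muMin (A h)) l (𝓝 0)),
          ∀ᶠ h in l, ∀ f : EuclideanSpace ℝ (Fin (N h)), f ≠ 0 →
            RBURA.relError α r (hA h).isHermitian f ≤ (RBURA.lamMin (A h)) ^ (-α) ∧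
            RBURA.relError α r (hA h).isHermitian f ≤ c ^ (-α)) := by
  have hα : α ∈ Set.Ioo (0 : ℝ) 1 := ⟨hα0, hα1⟩
  refine ⟨exists_isBURA hα0 k, fun r hr => ?_⟩
  obtain ⟨S, hcard, hS⟩ := hr.exists_zeros hα
  obtain ⟨hPk, hQk, happ, -⟩ := hr.reduced hα0
  have hS0 : ∀ t ∈ S, 0 < t := fun t ht => ((hS t).1 ht).1.1
  have hF : ∀ t ∈ S, r.denom.eval t * t ^ α = r.num.eval t := fun t ht => ((hS t).1 ht).2
  have hQm := RatFunc.monic_denom r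
  have hQpos : ∀ t, 0 ≤ t → 0 < r.denom.eval t := fun t ht =>
    denom_pos hα hS0 hcard hPk hQk hQm hF ht
  have hmono : ∀ u t, 0 ≤ u → u < t → val r u < val r t := fun u t hu hut => by
    rw [val_eq, val_eq]
    exact interpolant_strictMono hα hS0 hk hcard hPk hQk hQm hF hu hut
  set o := S.orderEmbOfFin hcard with ho
  have hoS : ∀ j, o j ∈ S := fun j => S.orderEmbOfFin_mem hcard j
  -- on the relevant intervals the best approximation lies above `t ^ α`
  have habove : ∀ t, 0 < t → ∀ i, i ≤ k →
      (∀ j : Fin (2 * k + 1), (j : ℕ) < 2 * i → o j ≤ t) →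
      (∀ j : Fin (2 * k + 1), 2 * i ≤ (j : ℕ) → t ≤ o j) → t ^ α ≤ val r t := by
    intro t ht i hi hlt hgt
    rw [val_eq, le_div_iff₀ (hQpos t ht.le)]
    by_cases htS : t ∈ S
    · rw [mul_comm, hF t htS]
    · have hne : ∀ j, o j ≠ t := fun j h => htS (h ▸ hoS j)
      have hneg := prod_sub_orderEmb_neg hcard hi
        (fun j hj => lt_of_le_of_ne (hlt j hj) (hne j))
        (fun j hj => lt_of_le_of_ne (hgt j hj) (hne j).symm)
      have hpos := mul_residual_pos hα hS0 hcard hPk hQk hQm.ne_zero hF ht htS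
      have h1 := neg_of_mul_pos_right hpos hneg.le
      have h2 := neg_of_mul_neg_right h1 (hQpos t ht.le).le
      linarith
  -- This shifts the zero-based enumeration to one-based indices; values outside `1, …, 2k+1` play
  -- no role.
  set ξ : ℕ → ℝ := fun n => if h : n - 1 < 2 * k + 1 then o ⟨n - 1, h⟩ else 0 with hξ
  have hξo : ∀ (n : ℕ) (h : n < 2 * k + 1), ξ (n + 1) = o ⟨n, h⟩ := fun n h => by
    simp only [hξ, Nat.add_sub_cancel, dif_pos h]
  have hfirst : ∀ t, 0 < t → t ≤ ξ 1 → t ^ α ≤ val r t := by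
    intro t ht ht1
    rw [hξo 0 (by omega)] at ht1
    refine habove t ht 0 (Nat.zero_le _) (fun j hj => by omega) fun j _ => ht1.trans ?_
    exact o.monotone (Fin.mk_le_of_le_val (Nat.zero_le _))
  have hξ1 : 0 < ξ 1 := by
    rw [hξo 0 (by omega)]
    exact hS0 _ (hoS _)
  have hvpos : ∀ t, 0 < t → 0 < val r t := by
    intro t ht
    -- Choosing `s < t` with `s ≤ ξ 1` gives `r(t) > r(s) ≥ s ^ α > 0`, so `r` is positive even
    -- where it lies below `t ^ α`.
    set s := min (t / 2) (ξ 1) with hs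
    have hs0 : 0 < s := lt_min (by positivity) hξ1
    have h1 := hfirst s hs0 (min_le_right _ _)
    have h2 := hmono s t hs0.le (lt_of_le_of_lt (min_le_left _ _) (by linarith))
    exact (Real.rpow_pos_of_pos hs0 _).trans_le (h1.trans h2.le)
  have hmatrix : ∀ (N : ℕ) (_ : 0 < N) (A : Matrix (Fin N) (Fin N) ℝ) (hA : A.PosDef),
      0 < rowNorm A ∧ 0 < muMin A ∧ lamMin A = rowNorm A * muMin A ∧
      ∀ i, muMin A ≤ (rowNorm A)⁻¹ * hA.isHermitian.eigenvalues i ∧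
        (rowNorm A)⁻¹ * hA.isHermitian.eigenvalues i ≤ 1 := by
    intro N hN A hA
    obtain ⟨i₀, hi₀⟩ := exists_lamMin_eq hN hA.isHermitian
    have hl : 0 < lamMin A := hi₀ ▸ hA.eigenvalues_pos i₀
    have hC : 0 < rowNorm A :=
      (hA.eigenvalues_pos i₀).trans_le (eigenvalues_le_rowNorm hA.isHermitian i₀)
    refine ⟨hC, mul_pos (inv_pos.2 hC) hl, ?_, fun i => ⟨?_, ?_⟩⟩
    · rw [muMin, mul_inv_cancel_left₀ hC.ne']
    · exact mul_le_mul_of_nonneg_left (lamMin_le hA.isHermitian i) (inv_pos.2 hC).le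
    · rw [inv_mul_le_iff₀ hC, mul_one]
      exact eigenvalues_le_rowNorm hA.isHermitian i
  have hsmall : ∀ (N : ℕ) (_ : 0 < N) (A : Matrix (Fin N) (Fin N) ℝ) (hA : A.PosDef),
      muMin A ≤ ξ 1 → ∀ f : EuclideanSpace ℝ (Fin N), f ≠ 0 →
        relError α r hA.isHermitian f ≤ lamMin A ^ (-α) := by
    intro N hN A hA hμ f hf
    obtain ⟨hC, hμ0, hlam, hev⟩ := hmatrix N hN A hA
    have hpos : ∀ i, 0 < (rowNorm A)⁻¹ * hA.isHermitian.eigenvalues i :=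
      fun i => hμ0.trans_le (hev i).1
    refine relError_le hA.isHermitian (fun i => (hQpos _ (hpos i).le).ne')
      (fun i => (hvpos _ (hpos i)).ne')
      (Real.rpow_nonneg (hlam ▸ (mul_pos hC hμ0).le) _) (fun i => ?_) hf
    have hρ : muMin A ^ α ≤ val r ((rowNorm A)⁻¹ * hA.isHermitian.eigenvalues i) := by
      refine (hfirst _ hμ0 hμ).trans ?_
      rcases (hev i).1.eq_or_lt with h | h
      exacts [h ▸ le_rfl, (hmono _ _ hμ0.le h).le]
    have := abs_inv_sub_rpow_le' hC hα0 hμ0 (hev i).1 hρ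
    rwa [mul_inv_cancel_left₀ hC.ne', ← hlam] at this
  refine ⟨ξ, ?_, ?_, ?_, ?_⟩
  · rintro a ⟨ha1, ha2⟩ b ⟨hb1, hb2⟩ hab
    obtain ⟨a, rfl⟩ := Nat.exists_eq_add_of_le' ha1
    obtain ⟨b, rfl⟩ := Nat.exists_eq_add_of_le' hb1
    rw [hξo a (by omega), hξo b (by omega)]
    exact o.strictMono (Fin.mk_lt_mk.2 (by omega))
  · have hz : ∀ t, t ∈ {t ∈ Set.Ioo (0 : ℝ) 1 | val r t - t ^ α = 0} ↔ t ∈ S := by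
      intro t
      rw [hS t, Set.mem_ofPred_eq]
      refine and_congr_right fun ht => ?_
      rw [val_eq, sub_eq_zero, div_eq_iff (hQpos t ht.1.le).ne', eq_comm, mul_comm]
    ext t
    rw [hz t]
    constructor
    · rintro ⟨n, ⟨hn1, hn2⟩, rfl⟩
      obtain ⟨n, rfl⟩ := Nat.exists_eq_add_of_le' hn1
      rw [hξo n (by omega)]
      exact hoS _
    · intro ht
      have : t ∈ Set.range o := by
        rw [ho, Finset.range_orderEmbOfFin]
        exact ht
      obtain ⟨j, rfl⟩ := this
      exact ⟨j + 1, ⟨by omega, by have := j.isLt; omega⟩, hξo j j.isLt⟩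
  · intro N hN A hA
    obtain ⟨hC, hμ0, hlam, hev⟩ := hmatrix N hN A hA
    have hpos : ∀ i, 0 < (rowNorm A)⁻¹ * hA.isHermitian.eigenvalues i :=
      fun i => hμ0.trans_le (hev i).1
    have hd : ∀ i, r.denom.eval ((rowNorm A)⁻¹ * hA.isHermitian.eigenvalues i) ≠ 0 :=
      fun i => (hQpos _ (hpos i).le).ne'
    have hv : ∀ i, val r ((rowNorm A)⁻¹ * hA.isHermitian.eigenvalues i) ≠ 0 :=
      fun i => (hvpos _ (hpos i)).ne'
    refine ⟨?_, ?_, ?_, fun hμ => hsmall N hN A hA hμ.2⟩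
    · rw [aeval_rescaled hA.isHermitian]
      exact isUnit_diagConj _ hd
    · rw [ratMat_rescaled hA.isHermitian hd]
      exact isUnit_diagConj _ hv
    · rintro ⟨i, ⟨hi1, hik⟩, hμ⟩ f hf
      have hE0 : 0 ≤ bestError (1 - α) k k := by
        rw [bestError]
        exact ENNReal.toReal_nonneg
      -- Exactly the nodes with zero-based index below `2i` lie at or to the left of `μ₁`; ties at
      -- the endpoints are allowed by `habove`.
      have hge : muMin A ^ α ≤ val r (muMin A) := by
        obtain ⟨n, rfl⟩ := Nat.exists_eq_add_of_le' hi1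
        rw [show 2 * (n + 1) = 2 * n + 1 + 1 by ring, hξo (2 * n + 1) (by omega),
          hξo (2 * n + 1 + 1) (by omega)] at hμ
        refine habove _ hμ0 (n + 1) hik (fun j hj => le_trans (o.monotone ?_) hμ.1)
          (fun j hj => le_trans hμ.2 (o.monotone ?_))
        · exact Fin.mk_le_mk.2 (by omega)
        · exact Fin.mk_le_of_le_val (by omega)
      refine relError_le hA.isHermitian hd hv ?_ (fun j => ?_) hf
      · have h1 : 0 < rowNorm A ^ α := Real.rpow_pos_of_pos hC _
        have h2 : 0 ≤ lamMin A ^ (2 * α) := Real.rpow_nonneg (hlam ▸ (mul_pos hC hμ0).le) _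
        positivity
      · have hρ : muMin A ^ α ≤ val r ((rowNorm A)⁻¹ * hA.isHermitian.eigenvalues j) := by
          refine hge.trans ?_
          rcases (hev j).1.eq_or_lt with h | h
          exacts [h ▸ le_rfl, (hmono _ _ hμ0.le h).le]
        have herr : |val r ((rowNorm A)⁻¹ * hA.isHermitian.eigenvalues j) -
            ((rowNorm A)⁻¹ * hA.isHermitian.eigenvalues j) ^ α| ≤ bestError (1 - α) k k := by
          have hq := hQpos _ (hpos j).le
          rw [val_eq, div_sub' hq.ne', abs_div, div_le_iff₀ (abs_pos.2 hq.ne'),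
            mul_comm (Polynomial.eval _ r.denom)]
          exact happ _ ⟨(hpos j).le, (hev j).2⟩
        have := abs_inv_sub_rpow_le hC hα0 hμ0 (hev j).1 hρ herr
        rwa [mul_inv_cancel_left₀ hC.ne', ← hlam] at this
  · intro ι l N hN A hA c hc hlam hμ
    -- For fixed `k` the point `ξ 1` is a fixed positive number, so eventually `μ₁ < ξ 1` and the
    -- second bound applies.
    filter_upwards [hlam, hμ.eventually (gt_mem_nhds hξ1)] with h hlh hμh f hf
    have h1 := hsmall (N h) (hN h) (A h) (hA h) hμh.le f hf
    exact ⟨h1, h1.trans (Real.rpow_le_rpow_of_nonpos hc hlh (by linarith))⟩
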